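/- Conventions. A (Spitzweck) left semimodel category is a bicomplete category with classes of weak equivalences, cofibrations and fibrations such that: weak equivalences satisfy two-out-of-three; all three classes are closed under retracts; fibrations and acyclic fibrations are stable under pullback; the initial object is cofibrant; cofibrations lift against acyclic fibrations; acyclic cofibrations with cofibrant source lift against fibrations; every map factors as a cofibration followed by an acyclic fibration; and every map with cofibrant source factors as an acyclic cofibration followed by a fibration. It is tractable if it is cofibrantly generated by sets $I$ and $J$ of maps with cofibrant sources: $I$ consists of cofibrations, $J$ of acyclic cofibrations, the acyclic fibrations (resp. fibrations) are the maps with the right lifting property against $I$ (resp. $J$), the sources of $I$ are small relative to relative $I$-cell complexes, and those of $J$ are small relative to relative $J$-cell complexes with cofibrant source. An adjunction $F\dashv U$ between left semimodel categories is a Quillen pair if $U$ preserves fibrations and acyclic fibrations. For a set $S$ of maps of a left semimodel category $\mathcal M$, an object $Z$ is $S$-local if it is fibrant and $\mathrm{map}(s,Z)$ is a weak homotopy equivalence of simplicial sets for every $s\in S$; here, for $Z$ fibrant, $\mathrm{map}(X,Z)=\mathrm{Hom}(X^\bullet,Z)$ is the homotopy function complex computed from a cosimplicial resolution $X^\bullet$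 of $X$ (a Reedy cofibrant cosimplicial object with a levelwise weak equivalence to the constant object $X$). A map $f$ is an $S$-local equivalence if $\mathrm{map}(f,Z)$ is a weak homotopy equivalence for every $S$-local $Z$. The left Bousfield localization $\mathrm L_S\mathcal M$ is the left semimodel structure on the category $\mathcal M$ with the same cofibrations as $\mathcal M$ and with the $S$-local equivalences as weak equivalences. Lemma. Let $F\colon\mathcal M\rightleftarrows\mathcal N:\!U$ be a Quillen pair between tractable left semimodel categories. Let $S$ and $T$ be sets of maps of $\mathcal M$ and $\mathcal N$ respectively, such that $\mathrm L_S\mathcal M$ and $\mathrm L_T\mathcal N$ exist as tractable left semimodel categories. Then $F\colon \mathrm L_S\mathcal M\rightleftarrows \mathrm L_T\mathcal N:\!U$ is a Quillen pair if and only if $U$ sends $T$-local objects to $S$-local objects. -/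

import Mathlib

open CategoryTheory Limits HomotopicalAlgebra MonoidalCategory Simplicial

universe v u u₁ u₂

noncomputable section

/-! ### Weak homotopy equivalences of simplicial sets -/

/-- The set of homotopy classes of maps `X ⟶ K`: the quotient of the set of maps by the
equivalence relation generated by simplicial homotopy (for `K` a Kan complex, simplicial
homotopy already is an equivalence relation). -/
def SSetHomotopyClasses (X K : SSet.{v}) : Type v :=
  Quot (fun f g : X ⟶ K => Nonempty (SSet.Homotopy f g))

/-- Precomposition with `f : X ⟶ Y` on homotopy classes, `[Y, K] → [X, K]`. -/
def SSetHomotopyClasses.precomp {X Y : SSet.{v}} (f : X ⟶ Y) (K : SSet.{v}) :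
    SSetHomotopyClasses Y K → SSetHomotopyClasses X K :=
  Quot.map (fun g => f ≫ g) (fun _ _ ⟨H⟩ =>
    ⟨H.precomp (SSet.RelativeMorphism.botEquiv.symm f) (SSet.Subcomplex.isInitialBot.hom_ext _ _)⟩)

/-- A map of simplicial sets is a weak homotopy equivalence if it induces bijections
`[Y, K] → [X, K]` on homotopy classes of maps into every Kan complex `K`. -/
def IsWeakHomotopyEquivalence {X Y : SSet.{v}} (f : X ⟶ Y) : Prop :=
  ∀ (K : SSet.{v}) [SSet.KanComplex K],
    Function.Bijective (SSetHomotopyClasses.precomp f K)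

/-! ### Latching objects of cosimplicial objects

Cosimplicial objects of `C` are functors `SimplexCategory ⥤ C`. -/

/-- The latching category at `n`: the injective, non-identity maps `[k] ⟶ [n]` in the simplex
category, as a full subcategory of the category of objects over `[n]`. (The only
automorphism of `[n]` is the identity.) -/
abbrev LatchingCategory (n : SimplexCategory) : Type :=
  ObjectProperty.FullSubcategory
    (fun f : Over n => Mono f.hom ∧ ¬ IsIso f.hom)

section

variable {C : Type u} [Category.{v} C]

/-- The diagram `([k] ⟶ [n]) ↦ X^k` on the latching category. -/
abbrev latchingDiagram (X : SimplexCategory ⥤ C) (n : SimplexCategory) :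
    LatchingCategory n ⥤ C :=
  ObjectProperty.ι _ ⋙ Over.forget n ⋙ X

/-- The canonical cocone with point `X^n` on the latching diagram. -/
@[simps]
def latchingCocone (X : SimplexCategory ⥤ C) (n : SimplexCategory) :
    Cocone (latchingDiagram X n) where
  pt := X.obj n
  ι :=
    { app := fun f => X.map f.obj.hom
      naturality := fun f g φ => by
        dsimp
        rw [Category.comp_id, ← X.map_comp, Over.w] }

instance [HasColimits C] (n : SimplexCategory) : HasColimitsOfShape (LatchingCategory n) C :=
  have := hasColimitsOfSizeShrink.{0, 0, v, v} C
  inferInstance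

/-- The latching map `L_n X ⟶ X^n`. -/
def latchingMap [HasColimits C] (X : SimplexCategory ⥤ C) (n : SimplexCategory) :
    colimit (latchingDiagram X n) ⟶ X.obj n :=
  colimit.desc (latchingDiagram X n) (latchingCocone X n)

/-- The simplicial set `n ↦ Hom(X^n, Z)`. -/
def cosimplicialHom (X : SimplexCategory ⥤ C) (Z : C) : SSet.{v} :=
  X.op ⋙ yoneda.obj Z

/-- The map `Hom(Y^•, Z) ⟶ Hom(X^•, Z)` given by precomposition with `φ : X ⟶ Y`. -/
def cosimplicialHomMap {X Y : SimplexCategory ⥤ C} (φ : X ⟶ Y) (Z : C) :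
    cosimplicialHom Y Z ⟶ cosimplicialHom X Z :=
  Functor.whiskerRight (NatTrans.op φ) (yoneda.obj Z)

end

/-! ### Left semimodel categories -/

/-- A (Spitzweck) left semimodel structure on a bicomplete category `C`. In contrast to a model
structure, acyclic cofibrations are only required to lift against fibrations when their source
is cofibrant, and only the maps with cofibrant source are required to factor as an acyclic
cofibration followed by a fibration. -/
structure LeftSemimodelStructure (C : Type u) [Category.{v} C] [HasLimits C] [HasColimits C] where
  /-- the weak equivalences -/
  weq : MorphismProperty C
  /-- the cofibrations -/
  cof : MorphismProperty C
  /-- the fibrations -/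
  fib : MorphismProperty C
  weq_two_out_of_three : weq.HasTwoOutOfThreeProperty
  weq_retract : weq.IsStableUnderRetracts
  cof_retract : cof.IsStableUnderRetracts
  fib_retract : fib.IsStableUnderRetracts
  /-- fibrations and acyclic fibrations are stable under pullback -/
  fib_pullback : fib.IsStableUnderBaseChange
  acyclicFib_pullback : (fib ⊓ weq).IsStableUnderBaseChange
  /-- the initial object is cofibrant -/
  initial_cofibrant : cof (initial.to (⊥_ C))
  lift_cof_acyclicFib {A B X Y : C} (i : A ⟶ B) (p : X ⟶ Y) :
    cof i → (fib ⊓ weq) p → HasLiftingProperty i p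
  lift_acyclicCof_fib {A B X Y : C} (i : A ⟶ B) (p : X ⟶ Y) :
    cof (initial.to A) → (cof ⊓ weq) i → fib p → HasLiftingProperty i p
  factor_cof_acyclicFib {X Y : C} (f : X ⟶ Y) :
    Nonempty (MorphismProperty.MapFactorizationData cof (fib ⊓ weq) f)
  factor_acyclicCof_fib {X Y : C} (f : X ⟶ Y) :
    cof (initial.to X) → Nonempty (MorphismProperty.MapFactorizationData (cof ⊓ weq) fib f)

namespace LeftSemimodelStructure

variable {C : Type u} [Category.{v} C] [HasLimits C] [HasColimits C]
  (A : LeftSemimodelStructure C)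

/-- `X` is cofibrant if `∅ ⟶ X` is a cofibration. -/
def IsCofibrant (X : C) : Prop := A.cof (initial.to X)

/-- `X` is fibrant if `X ⟶ *` is a fibration. -/
def IsFibrant (X : C) : Prop := A.fib (terminal.from X)

/-- The acyclic cofibrations. -/
def acyclicCof : MorphismProperty C := A.cof ⊓ A.weq

/-- The acyclic fibrations. -/
def acyclicFib : MorphismProperty C := A.fib ⊓ A.weq

/-- The sources of the maps in `J` are small relative to the relative `J`-cell complexes with
cofibrant source: for some regular cardinal `κ`, mapping out of such a source commutes
with the colimit of the `κ`-indexed sequence of any relative `J`-cell complex `f : X ⟶ Y`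
(at each stage, a set of cells is attached) such that `X` is cofibrant. -/
def DomainsSmallRelCofibrantCells (J : MorphismProperty C) : Prop :=
  ∃ (κ : Cardinal.{v}) (_ : Fact κ.IsRegular) (_ : OrderBot κ.ord.ToType),
    ∀ {K L : C} (j : K ⟶ L), J j → ∀ {X Y : C} (f : X ⟶ Y), A.IsCofibrant X →
      ∀ (hf : RelativeCellComplex.{v} (fun (_ : κ.ord.ToType) => J.homFamily) f),
        PreservesColimit hf.F (coyoneda.obj (Opposite.op K))

/-- The left semimodel structure is cofibrantly generated by sets `I` (generating
cofibrations) and `J` (generating acyclic cofibrations). -/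
structure IsCofibrantlyGeneratedBy (I J : MorphismProperty C) : Prop where
  isSmall_I : MorphismProperty.IsSmall.{v} I
  isSmall_J : MorphismProperty.IsSmall.{v} J
  le_cof : I ≤ A.cof
  le_acyclicCof : J ≤ A.acyclicCof
  acyclicFib_eq : A.acyclicFib = I.rlp
  fib_eq : A.fib = J.rlp
  /-- the sources of the maps in `I` are small relative to the relative `I`-cell complexes -/
  smallObjectArgument_I : MorphismProperty.HasSmallObjectArgument.{v} I
  small_J : A.DomainsSmallRelCofibrantCells J

/-- Tractable: cofibrantly generated by sets of maps with cofibrant sources. -/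
def IsTractable : Prop :=
  ∃ I J : MorphismProperty C, A.IsCofibrantlyGeneratedBy I J ∧
    (∀ ⦃X Y : C⦄ (i : X ⟶ Y), I i → A.IsCofibrant X) ∧
    (∀ ⦃X Y : C⦄ (j : X ⟶ Y), J j → A.IsCofibrant X)

/-! ### Homotopy function complexes, local objects, local equivalences -/

/-- Reedy cofibrant cosimplicial objects: all latching maps are cofibrations. -/
def IsReedyCofibrant (X : SimplexCategory ⥤ C) : Prop :=
  ∀ n : SimplexCategory, A.cof (latchingMap X n)

/-- A cosimplicial resolution of `X`: a Reedy cofibrant cosimplicial object with a levelwise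
weak equivalence to the constant cosimplicial object at `X`. -/
structure CosimplicialResolution (X : C) where
  /-- the cosimplicial object -/
  obj : SimplexCategory ⥤ C
  /-- the augmentation -/
  π : obj ⟶ (Functor.const SimplexCategory).obj X
  reedyCofibrant : A.IsReedyCofibrant obj
  weq_π (n : SimplexCategory) : A.weq (π.app n)

/-- For `Z` fibrant: the map of homotopy function complexes
`map(f, Z) : map(Y, Z) ⟶ map(X, Z)` is a weak homotopy equivalence. The homotopy function
complexes are computed as `Hom(X^•, Z)` and `Hom(Y^•, Z)` from a cosimplicial resolution
`X^• ⟶ Y^•` of `f`; the choice of this resolution does not matter. -/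
def InducesEquivalenceOnMap {X Y : C} (f : X ⟶ Y) (Z : C) : Prop :=
  ∃ (RX : A.CosimplicialResolution X) (RY : A.CosimplicialResolution Y) (φ : RX.obj ⟶ RY.obj),
    φ ≫ RY.π = RX.π ≫ (Functor.const SimplexCategory).map f ∧
    IsWeakHomotopyEquivalence (cosimplicialHomMap φ Z)

/-- `Z` is `S`-local: it is fibrant, and `map(s, Z)` is a weak homotopy equivalence for all
maps `s` in `S`. -/
def IsLocal (S : MorphismProperty C) (Z : C) : Prop :=
  A.IsFibrant Z ∧ ∀ ⦃X Y : C⦄ (s : X ⟶ Y), S s → A.InducesEquivalenceOnMap s Z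

/-- The `S`-local equivalences: the maps `f` such that `map(f, Z)` is a weak homotopy
equivalence for all `S`-local objects `Z`. -/
def localEquivalences (S : MorphismProperty C) : MorphismProperty C :=
  fun _ _ f => ∀ Z : C, A.IsLocal S Z → A.InducesEquivalenceOnMap f Z

/-- `L` is the left Bousfield localization of `A` at `S`: it has the same underlying category
and the same cofibrations, and its weak equivalences are the `S`-local equivalences. -/
structure IsLeftBousfieldLocalization (S : MorphismProperty C) (L : LeftSemimodelStructure C) :
    Prop where
  cof_eq : L.cof = A.cof
  weq_eq : L.weq = A.localEquivalences S

end LeftSemimodelStructure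

/-! ### Quillen pairs -/

/-- The adjunction `F ⊣ U` is a Quillen pair between the left semimodel categories
`(M, A)` and `(N, B)`: `U` preserves fibrations and acyclic fibrations. -/
structure IsQuillenPair {M : Type u₁} [Category.{v} M] [HasLimits M] [HasColimits M]
    {N : Type u₂} [Category.{v} N] [HasLimits N] [HasColimits N]
    {F : M ⥤ N} {U : N ⥤ M} (_adj : F ⊣ U)
    (A : LeftSemimodelStructure M) (B : LeftSemimodelStructure N) : Prop where
  map_fib ⦃X Y : N⦄ (p : X ⟶ Y) : B.fib p → A.fib (U.map p)
  map_acyclicFib ⦃X Y : N⦄ (p : X ⟶ Y) : B.acyclicFib p → A.acyclicFib (U.map p)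

end

/-!
Write `LM` and `LN` for the localizations `L_S M` and `L_T N`. A localization has the same
cofibrations, hence the same acyclic fibrations, as the original structure, so only the
preservation of fibrations is at stake.

Suppose that `U` preserves local objects. The fibrations of `LM` are detected by generating acyclic
cofibrations `j : K ⟶ L` of `LM` with cofibrant sources, so it suffices that `F j` is an acyclic
cofibration of `LN`, i.e. that `map(F j, Z)` is a weak homotopy equivalence for all `T`-local `Z`.
Since `F` preserves cosimplicial resolutions of cofibrant objects, `map(F j, Z)` is `map(j, U Z)`
(`IsQuillenPair.inducesEquivalenceOnMap_map`), and `U Z` is `S`-local.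

Conversely, suppose that `U` preserves the fibrations of the localizations, and let `Z` be
`T`-local.

* `Z` is fibrant in `LN`: if `j : K ⟶ L` is a generating acyclic cofibration of `LN`, then
  `map(j, Z)` is surjective on connected components, so that any map `K ⟶ Z` extends to `L` up to
  homotopy, and then on the nose by the homotopy extension property
  (`LeftSemimodelStructure.InducesEquivalenceOnMap.exists_extension`). Hence `U Z` is fibrant in
  `LM`, and it is fibrant in `M` as `Z` is fibrant in `N`.
* An object `W` which is fibrant in `M` and in `LM` is `S`-local. Indeed, a map in `S` has a
  cosimplicial resolution `φ` which is a Reedy cofibration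
  (`LeftSemimodelStructure.exists_resolution`). It is levelwise a weak equivalence of `LM`, so its
  relative latching maps are acyclic cofibrations of `LM`, and `Hom(φ, W)` is an acyclic Kan
  fibration (`LeftSemimodelStructure.IsReedyCofibration.isWeakHomotopyEquivalence`). This uses that
  weak equivalences of `M` are local equivalences, which is the same statement for the trivial
  localization.

Resolutions are constructed from the small object argument in the category of cosimplicial objects,
applied to the maps freely generated in some degree by a generating cofibration. The maps with the
right lifting property with respect to these are the levelwise acyclic fibrations, and the maps
with the left lifting property with respect to the latter are Reedy cofibrations
(`LeftSemimodelStructure.isReedyCofibration_of_llp`).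
-/

noncomputable section

/-! ### Homotopy theory in a left semimodel category -/

namespace LeftSemimodelStructure

variable {C : Type u} [Category.{v} C] [HasLimits C] [HasColimits C]
  (A : LeftSemimodelStructure C)

lemma acyclicFib_llp : A.acyclicFib.llp = A.cof := by
  have : A.cof.HasFactorization A.acyclicFib := ⟨fun f => A.factor_cof_acyclicFib f⟩
  have := A.cof_retract
  exact MorphismProperty.llp_eq_of_le_llp_of_hasFactorization_of_isStableUnderRetracts
    (fun _ _ i hi _ _ p hp => A.lift_cof_acyclicFib i p hi hp)

lemma cof_rlp : A.cof.rlp = A.acyclicFib := by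
  have : A.cof.HasFactorization A.acyclicFib := ⟨fun f => A.factor_cof_acyclicFib f⟩
  have := A.fib_retract
  have := A.weq_retract
  have : A.acyclicFib.IsStableUnderRetracts :=
    inferInstanceAs (A.fib ⊓ A.weq).IsStableUnderRetracts
  exact MorphismProperty.rlp_eq_of_le_rlp_of_hasFactorization_of_isStableUnderRetracts
    (fun _ _ p hp _ _ i hi => A.lift_cof_acyclicFib i p hi hp)

lemma cof_comp {X Y Z : C} {i : X ⟶ Y} {j : Y ⟶ Z} (hi : A.cof i) (hj : A.cof j) :
    A.cof (i ≫ j) := by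
  rw [← acyclicFib_llp] at *
  exact MorphismProperty.comp_mem _ _ _ hi hj

lemma cof_of_isPushout {K L X Y : C} {f : K ⟶ X} {i : K ⟶ L} {i' : X ⟶ Y} {g : L ⟶ Y}
    (sq : IsPushout f i i' g) (hi : A.cof i) : A.cof i' := by
  rw [← acyclicFib_llp] at *
  exact MorphismProperty.of_isPushout sq hi

lemma weq_id (X : C) : A.weq (𝟙 X) := by
  have : A.acyclicFib (𝟙 X) := by
    rw [← cof_rlp]
    exact MorphismProperty.id_mem _ _
  exact this.2

lemma weq_comp {X Y Z : C} {f : X ⟶ Y} {g : Y ⟶ Z} (hf : A.weq f) (hg : A.weq g) :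
    A.weq (f ≫ g) :=
  have := A.weq_two_out_of_three
  MorphismProperty.comp_mem _ _ _ hf hg

lemma weq_of_precomp {X Y Z : C} {f : X ⟶ Y} {g : Y ⟶ Z} (hf : A.weq f)
    (hfg : A.weq (f ≫ g)) : A.weq g :=
  have := A.weq_two_out_of_three
  MorphismProperty.of_precomp _ _ _ hf hfg

lemma weq_of_postcomp {X Y Z : C} {f : X ⟶ Y} {g : Y ⟶ Z} (hg : A.weq g)
    (hfg : A.weq (f ≫ g)) : A.weq f :=
  have := A.weq_two_out_of_three
  MorphismProperty.of_postcomp _ _ _ hg hfg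

lemma exists_cof_acyclicFib {X Y : C} (f : X ⟶ Y) :
    ∃ (Z : C) (i : X ⟶ Z) (p : Z ⟶ Y), A.cof i ∧ A.acyclicFib p ∧ i ≫ p = f := by
  obtain ⟨h⟩ := A.factor_cof_acyclicFib f
  exact ⟨h.Z, h.i, h.p, h.hi, h.hp, h.fac⟩

variable {A}

lemma IsCofibrant.of_cof {X Y : C} (hX : A.IsCofibrant X) {i : X ⟶ Y} (hi : A.cof i) :
    A.IsCofibrant Y := by
  have := A.cof_comp hX hi
  rwa [initial.to_comp] at this

/-- The converse of the lifting axiom for acyclic cofibrations, by the retract argument. -/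
lemma acyclicCof_of_llp_fib {X Y : C} {i : X ⟶ Y} (hX : A.IsCofibrant X)
    (hi : A.fib.llp i) : A.acyclicCof i := by
  obtain ⟨h⟩ := A.factor_acyclicCof_fib i hX
  have := hi _ h.hp
  have := A.cof_retract
  have := A.weq_retract
  have : A.acyclicCof.IsStableUnderRetracts :=
    inferInstanceAs (A.cof ⊓ A.weq).IsStableUnderRetracts
  exact MorphismProperty.of_retract (RetractArrow.ofLeftLiftingProperty h.fac) h.hi

lemma llp_fib_of_acyclicCof {X Y : C} {i : X ⟶ Y} (hX : A.IsCofibrant X)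
    (hi : A.acyclicCof i) : A.fib.llp i :=
  fun _ _ p hp => A.lift_acyclicCof_fib i p hX hi hp

lemma acyclicCof_of_isPushout {K L X Y : C} {f : K ⟶ X} {i : K ⟶ L} {i' : X ⟶ Y} {g : L ⟶ Y}
    (sq : IsPushout f i i' g) (hi : A.acyclicCof i) (hK : A.IsCofibrant K)
    (hX : A.IsCofibrant X) : A.acyclicCof i' :=
  acyclicCof_of_llp_fib hX (MorphismProperty.of_isPushout sq (llp_fib_of_acyclicCof hK hi))

lemma exists_extension {X Y Z : C} {i : X ⟶ Y} (hX : A.IsCofibrant X)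
    (hi : A.acyclicCof i) (hZ : A.IsFibrant Z) (a : X ⟶ Z) : ∃ b : Y ⟶ Z, i ≫ b = a := by
  have := A.lift_acyclicCof_fib i (terminal.from Z) hX hi hZ
  have sq : CommSq a i (terminal.from Z) (terminal.from Y) := ⟨by subsingleton⟩
  exact ⟨sq.lift, sq.fac_left⟩

lemma cof_coprod_inl {X Y : C} (hY : A.IsCofibrant Y) :
    A.cof (coprod.inl : X ⟶ X ⨿ Y) :=
  A.cof_of_isPushout (IsPushout.of_hasBinaryCoproduct' X Y) hY

lemma cof_coprod_inr {X Y : C} (hX : A.IsCofibrant X) :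
    A.cof (coprod.inr : Y ⟶ X ⨿ Y) :=
  A.cof_of_isPushout (IsPushout.of_hasBinaryCoproduct' X Y).flip hX

/-- Ken Brown's factorization: a weak equivalence between cofibrant objects is an acyclic
cofibration followed by a retraction of an acyclic cofibration. -/
lemma exists_brown_factorization {X Y : C} {w : X ⟶ Y} (hX : A.IsCofibrant X)
    (hY : A.IsCofibrant Y) (hw : A.weq w) :
    ∃ (Z : C) (i : X ⟶ Z) (s : Y ⟶ Z) (r : Z ⟶ Y),
      A.acyclicCof i ∧ A.acyclicCof s ∧ i ≫ r = w ∧ s ≫ r = 𝟙 Y := by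
  obtain ⟨Z, q, r, hq, hr, fac⟩ := A.exists_cof_acyclicFib (coprod.desc w (𝟙 Y))
  have h₁ : (coprod.inl ≫ q) ≫ r = w := by
    rw [Category.assoc, fac, coprod.inl_desc]
  have h₂ : (coprod.inr ≫ q) ≫ r = 𝟙 Y := by
    rw [Category.assoc, fac, coprod.inr_desc]
  refine ⟨Z, coprod.inl ≫ q, coprod.inr ≫ q, r, ⟨?_, ?_⟩, ⟨?_, ?_⟩, h₁, h₂⟩
  · exact A.cof_comp (cof_coprod_inl hY) hq
  · exact A.weq_of_postcomp hr.2 (by rwa [h₁])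
  · exact A.cof_comp (cof_coprod_inr hX) hq
  · exact A.weq_of_postcomp hr.2 (by rw [h₂]; exact A.weq_id Y)

/-- The homotopy extension property of a cofibration `j : K ⟶ L` with cofibrant source, with
respect to a map `e : D ⟶ Z` to a fibrant object, where `D` is a cylinder object of `K`, the two
ends of which are not required to be cofibrations. -/
lemma exists_homotopy_extension {K L Z D : C} {j : K ⟶ L} (hj : A.cof j)
    (hK : A.IsCofibrant K) (hZ : A.IsFibrant Z) {i₀ i₁ : K ⟶ D} {σ : D ⟶ K} (hσ : A.weq σ)
    (h₀ : i₀ ≫ σ = 𝟙 K) (h₁ : i₁ ≫ σ = 𝟙 K) (e : D ⟶ Z) (l : L ⟶ Z) (h : i₀ ≫ e = j ≫ l) :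
    ∃ l' : L ⟶ Z, j ≫ l' = i₁ ≫ e := by
  have hL := hK.of_cof hj
  -- replace `D` by a cylinder `D'` whose two ends are cofibrations
  obtain ⟨D', q, p, hq, hp, fac⟩ := A.exists_cof_acyclicFib (coprod.desc i₀ i₁)
  have fac₀ : coprod.inl ≫ q ≫ p = i₀ := by rw [fac, coprod.inl_desc]
  have fac₁ : coprod.inr ≫ q ≫ p = i₁ := by rw [fac, coprod.inr_desc]
  have hi₀ : A.acyclicCof (coprod.inl ≫ q) := by
    refine ⟨A.cof_comp (cof_coprod_inl hK) hq, A.weq_of_postcomp (A.weq_comp hp.2 hσ) ?_⟩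
    have : (coprod.inl ≫ q) ≫ p ≫ σ = 𝟙 K := by
      rw [Category.assoc, reassoc_of% fac₀, h₀]
    rw [this]
    exact A.weq_id K
  -- glue `D'` to `L` along the first end, and complete to a cylinder of `L`
  let P := pushout j (coprod.inl ≫ q)
  have hP : A.acyclicCof (pushout.inl j (coprod.inl ≫ q)) :=
    acyclicCof_of_isPushout (IsPushout.of_hasPushout _ _) hi₀ hK hL
  let t : K ⟶ P := coprod.inr ≫ q ≫ pushout.inr j (coprod.inl ≫ q)
  have hPj : A.cof (pushout.inl t j) := A.cof_of_isPushout (IsPushout.of_hasPushout _ _) hj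
  let g : P ⟶ L := pushout.desc (𝟙 L) (p ≫ σ ≫ j) (by
    rw [Category.assoc, reassoc_of% fac₀, reassoc_of% h₀, Category.comp_id])
  have hg : t ≫ g = j ≫ 𝟙 L := by
    simp only [t, g, Category.assoc, pushout.inr_desc]
    rw [reassoc_of% fac₁, reassoc_of% h₁, Category.comp_id]
  obtain ⟨E, q', r, hq', hr, fac'⟩ := A.exists_cof_acyclicFib (pushout.desc g (𝟙 L) hg)
  have hE : A.acyclicCof (pushout.inl t j ≫ q') := by
    refine ⟨A.cof_comp hPj hq', A.weq_of_precomp hP.2 (A.weq_of_postcomp hr.2 ?_)⟩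
    have : (pushout.inl j (coprod.inl ≫ q) ≫ pushout.inl t j ≫ q') ≫ r = 𝟙 L := by
      simp only [Category.assoc, fac', g]
      rw [pushout.inl_desc, pushout.inl_desc]
    rw [this]
    exact A.weq_id L
  obtain ⟨m, hm⟩ := exists_extension (hL.of_cof hP.1) hE hZ
    (pushout.desc l (p ≫ e) (by rw [Category.assoc, reassoc_of% fac₀, h]))
  refine ⟨pushout.inr t j ≫ q' ≫ m, ?_⟩
  rw [← pushout.condition_assoc, ← Category.assoc _ q' m, hm]
  simp only [t, Category.assoc, pushout.inr_desc]
  rw [reassoc_of% fac₁]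

end LeftSemimodelStructure

/-! ### Weak homotopy equivalences of simplicial sets -/

namespace SSetHomotopyClasses

lemma precomp_id (X K : SSet.{v}) : precomp (𝟙 X) K = id := by
  ext ⟨f⟩
  exact congrArg (Quot.mk _) (Category.id_comp f)

lemma precomp_comp {X Y Z : SSet.{v}} (f : X ⟶ Y) (g : Y ⟶ Z) (K : SSet.{v}) :
    precomp (f ≫ g) K = precomp f K ∘ precomp g K := by
  ext ⟨h⟩
  exact congrArg (Quot.mk _) (Category.assoc f g h)

lemma precomp_eq_of_homotopy {X Y : SSet.{v}} {f g : X ⟶ Y} (H : X ⊗ Δ[1] ⟶ Y)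
    (h₀ : SSet.ι₀ ≫ H = f) (h₁ : SSet.ι₁ ≫ H = g) (K : SSet.{v}) :
    precomp f K = precomp g K := by
  ext ⟨a⟩
  refine Quot.sound ⟨?_⟩
  exact
    { h := H ≫ a
      h₀ := by rw [reassoc_of% h₀]; rfl
      h₁ := by rw [reassoc_of% h₁]; rfl
      rel := by
        ext n ⟨x, _⟩
        exact x.2.elim }

lemma precomp_bijective_of_isIso {X Y : SSet.{v}} (f : X ⟶ Y) [IsIso f] (K : SSet.{v}) :
    Function.Bijective (precomp f K) := by
  refine Function.bijective_iff_has_inverse.2 ⟨precomp (inv f) K, fun a => ?_, fun a => ?_⟩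
  · rw [← Function.comp_apply (f := precomp (inv f) K), ← precomp_comp, IsIso.inv_hom_id,
      precomp_id, id]
  · rw [← Function.comp_apply (f := precomp f K), ← precomp_comp, IsIso.hom_inv_id,
      precomp_id, id]

end SSetHomotopyClasses

lemma IsWeakHomotopyEquivalence.of_iso {X Y X' Y' : SSet.{v}} {f : X ⟶ Y} {f' : X' ⟶ Y'}
    (hf : IsWeakHomotopyEquivalence f) (a : X ≅ X') (b : Y ≅ Y') (h : f ≫ b.hom = a.hom ≫ f') :
    IsWeakHomotopyEquivalence f' := by
  intro K _
  have hf' : f' = a.inv ≫ f ≫ b.hom := by rw [h, Iso.inv_hom_id_assoc]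
  rw [hf', SSetHomotopyClasses.precomp_comp, SSetHomotopyClasses.precomp_comp]
  exact (SSetHomotopyClasses.precomp_bijective_of_isIso _ K).comp
    ((hf K).comp (SSetHomotopyClasses.precomp_bijective_of_isIso _ K))

namespace SSet

/-- A simplex of `∂Δ[1]` is constant. -/
lemma asOrderHom_eq_of_mem_boundary_one {m : SimplexCategoryᵒᵖ} {s : (Δ[1] : SSet.{v}).obj m}
    (hs : s ∈ (boundary.{v} 1).obj m) (i j : Fin (m.unop.len + 1)) :
    stdSimplex.asOrderHom s i = stdSimplex.asOrderHom s j := by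
  by_contra h
  refine hs fun k => ?_
  by_cases hk : stdSimplex.asOrderHom s i = k
  · exact ⟨i, hk⟩
  · exact ⟨j, by lia⟩

open Classical in
/-- The map `X ⊗ ∂Δ[1] ⟶ Y` given by two maps `f g : X ⟶ Y`. As the simplices of `∂Δ[1]` are
constant, their first vertex decides between `f` and `g`. -/
def boundaryOneDesc {X Y : SSet.{v}} (f g : X ⟶ Y) : X ⊗ (∂Δ[1] : SSet.{v}) ⟶ Y where
  app m := TypeCat.ofHom fun x =>
    if stdSimplex.asOrderHom x.2.1 0 = 0 then f.app m x.1 else g.app m x.1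
  naturality m m' θ := by
    ext ⟨x, s, hs⟩
    have h : stdSimplex.asOrderHom ((Δ[1] : SSet.{v}).map θ s) 0 = stdSimplex.asOrderHom s 0 :=
      asOrderHom_eq_of_mem_boundary_one hs _ _
    change (if stdSimplex.asOrderHom ((Δ[1] : SSet.{v}).map θ s) 0 = 0 then
      f.app m' (X.map θ x) else g.app m' (X.map θ x)) =
        Y.map θ (if stdSimplex.asOrderHom s 0 = 0 then f.app m x else g.app m x)
    rw [h]
    split_ifs
    · exact NatTrans.naturality_apply f θ x
    · exact NatTrans.naturality_apply g θ x

/-- A map with the right lifting property with respect to the boundary inclusions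
`∂Δ[n] ⟶ Δ[n]` is a weak homotopy equivalence: it has a section `s`, and the composition with
`s` on the other side is homotopic to the identity. -/
lemma isWeakHomotopyEquivalence_of_rlp {X Y : SSet.{v}} {p : X ⟶ Y}
    (hp : modelCategoryQuillen.I.rlp p) : IsWeakHomotopyEquivalence p := by
  rw [← rlp_monomorphisms] at hp
  obtain ⟨s, hs⟩ : ∃ s : Y ⟶ X, s ≫ p = 𝟙 Y := by
    have := hp (initial.to Y) (MorphismProperty.monomorphisms.infer_property _)
    have sq : CommSq (initial.to X) (initial.to Y) p (𝟙 Y) := ⟨by subsingleton⟩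
    exact ⟨sq.lift, sq.fac_right⟩
  obtain ⟨H, h₀, h₁⟩ : ∃ H : X ⊗ Δ[1] ⟶ X, ι₀ ≫ H = p ≫ s ∧ ι₁ ≫ H = 𝟙 X := by
    let i : X ⊗ (∂Δ[1] : SSet.{v}) ⟶ X ⊗ Δ[1] := X ◁ ∂Δ[1].ι
    have hi : Mono i := ⟨fun a b h => by
      apply CartesianMonoidalCategory.hom_ext
      · simpa [i] using h =≫ CartesianMonoidalCategory.fst _ _
      · rw [← cancel_mono ∂Δ[1].ι]
        simpa [i] using h =≫ CartesianMonoidalCategory.snd _ _⟩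
    have := hp i (MorphismProperty.monomorphisms.infer_property _)
    have sq : CommSq (boundaryOneDesc (p ≫ s) (𝟙 X)) i p
        (CartesianMonoidalCategory.fst X Δ[1] ≫ p) := ⟨by
      ext m ⟨x, t, ht⟩
      change p.app m (if stdSimplex.asOrderHom t 0 = 0 then s.app m (p.app m x) else x) =
        p.app m x
      split_ifs
      · exact ConcreteCategory.congr_hom (congr_app hs m) (p.app m x)
      · rfl⟩
    have hl := sq.fac_left
    have hc (k : Fin 2) (m : SimplexCategoryᵒᵖ) :
        stdSimplex.const 1 k m ∈ (boundary.{v} 1).obj m := fun h => by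
      obtain ⟨_, h⟩ := h (1 - k)
      change k = 1 - k at h
      lia
    refine ⟨sq.lift, ?_, ?_⟩
    · ext m x
      let z : (X ⊗ (∂Δ[1] : SSet.{v})).obj m := (x, ⟨_, hc 0 m⟩)
      have h : (boundaryOneDesc (p ≫ s) (𝟙 X)).app m z = (p ≫ s).app m x :=
        if_pos (e := x) (show stdSimplex.asOrderHom (stdSimplex.const.{v} 1 0 m) 0 = 0 from rfl)
      exact (ConcreteCategory.congr_hom (congr_app hl m) z).trans h
    · ext m x
      let z : (X ⊗ (∂Δ[1] : SSet.{v})).obj m := (x, ⟨_, hc 1 m⟩)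
      have h : (boundaryOneDesc (p ≫ s) (𝟙 X)).app m z = (𝟙 X : X ⟶ X).app m x :=
        if_neg (t := s.app m (p.app m x))
          (show stdSimplex.asOrderHom (stdSimplex.const.{v} 1 1 m) 0 ≠ 0 from one_ne_zero)
      exact (ConcreteCategory.congr_hom (congr_app hl m) z).trans h
  intro K _
  refine Function.bijective_iff_has_inverse.2
    ⟨SSetHomotopyClasses.precomp s K, fun a => ?_, fun a => ?_⟩
  · rw [← Function.comp_apply (f := SSetHomotopyClasses.precomp s K),
      ← SSetHomotopyClasses.precomp_comp, hs, SSetHomotopyClasses.precomp_id, id]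
  · rw [← Function.comp_apply (f := SSetHomotopyClasses.precomp p K),
      ← SSetHomotopyClasses.precomp_comp, SSetHomotopyClasses.precomp_eq_of_homotopy H h₀ h₁,
      SSetHomotopyClasses.precomp_id, id]

/-! ### Weak homotopy equivalences are surjective on connected components -/

/-- The discrete simplicial set on a type `T`. -/
abbrev discrete (T : Type v) : SSet.{v} := (Functor.const _).obj T

lemma yonedaEquiv_comp_discrete {T : Type v} {m n : SimplexCategory}
    (f : stdSimplex.obj m ⟶ stdSimplex.obj n) (g : stdSimplex.obj n ⟶ discrete T) :
    yonedaEquiv (f ≫ g) = yonedaEquiv g := by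
  obtain ⟨f, rfl⟩ := stdSimplex.map_surjective f
  exact (yonedaEquiv_naturality f g).symm

instance (T : Type v) : KanComplex (discrete T) := by
  rw [KanComplex.iff]
  intro n i f hf
  obtain ⟨j₀, hj₀⟩ := exists_ne i
  -- all faces of the horn contain the vertex `i`
  have key (j : Fin (n + 2)) (hj : j ≠ i) : yonedaEquiv (f j hj) = yonedaEquiv (f j₀ hj₀) := by
    have hv (j : Fin (n + 2)) (hj : j ≠ i) : ∃ w : Δ[0] ⟶ (Δ[n] : SSet.{v}),
        w ≫ stdSimplex.δ j = SSet.const (stdSimplex.obj₀Equiv.symm i) := by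
      obtain ⟨k, hk⟩ := Fin.exists_succAbove_eq hj.symm
      refine ⟨SSet.const (stdSimplex.obj₀Equiv.symm k), ?_⟩
      rw [SSet.const_comp, ← hk]
      rfl
    obtain ⟨w, hw⟩ := hv j hj
    obtain ⟨w₀, hw₀⟩ := hv j₀ hj₀
    have h : w ≫ horn.ι i j hj = w₀ ≫ horn.ι i j₀ hj₀ := by
      rw [← cancel_mono Λ[n + 1, i].ι]
      simp [hw, hw₀]
    have h' : w ≫ f j hj = w₀ ≫ f j₀ hj₀ := by
      rw [← hf.ι_desc j hj, ← hf.ι_desc j₀ hj₀, reassoc_of% h]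
    rw [← yonedaEquiv_comp_discrete w, h', yonedaEquiv_comp_discrete]
  let t : T := yonedaEquiv (f j₀ hj₀)
  refine ⟨yonedaEquiv.symm t, fun j hj => yonedaEquiv.injective ?_⟩
  rw [yonedaEquiv_comp_discrete, Equiv.apply_symm_apply, key j hj]

/-- A function on the connected components of a simplicial set, as a map to a discrete
simplicial set. -/
def toDiscrete {X : SSet.{v}} {T : Type v} (g : π₀ X → T) : X ⟶ discrete T where
  app n := TypeCat.ofHom fun x => g (π₀.mk (X.map ((SimplexCategory.const ⦋0⦌ n.unop 0).op) x))
  naturality n m θ := by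
    ext x
    refine congrArg g ?_
    let e : ⦋1⦌ ⟶ n.unop :=
      SimplexCategory.mkOfLe (n := n.unop.len) 0 (θ.unop.toOrderHom 0) (Fin.zero_le _)
    have h₁ : SimplexCategory.const ⦋0⦌ m.unop 0 ≫ θ.unop = SimplexCategory.δ 0 ≫ e := by
      ext k
      fin_cases k
      rfl
    have h₀ : SimplexCategory.const ⦋0⦌ n.unop 0 = SimplexCategory.δ 1 ≫ e := by
      ext k
      fin_cases k
      rfl
    refine (π₀.sound (Edge.ofEq (Edge.mk' (X.map e.op x)) ?_ ?_)).symm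
    · rw [h₀, op_comp, Functor.map_comp_apply]
      rfl
    · change _ = X.map _ (X.map θ x)
      rw [← Functor.map_comp_apply, ← Quiver.Hom.op_unop θ, ← op_comp, h₁, op_comp,
        Functor.map_comp_apply]
      rfl

lemma toDiscrete_app_zero {X : SSet.{v}} {T : Type v} (g : π₀ X → T) (x : X _⦋0⦌) :
    (toDiscrete g).app _ x = g (π₀.mk x) := by
  have : SimplexCategory.const ⦋0⦌ ⦋0⦌ 0 = 𝟙 _ := by
    ext k
    fin_cases k
    rfl
  change g (π₀.mk (X.map (SimplexCategory.const ⦋0⦌ ⦋0⦌ 0).op x)) = _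
  rw [this, op_id, Functor.map_id_apply]

/-- Homotopic maps to a discrete simplicial set agree on vertices. -/
lemma app_zero_eq_of_homotopy {X : SSet.{v}} {T : Type v} {f g : X ⟶ discrete T}
    (H : Homotopy f g) (x : X _⦋0⦌) : f.app _ x = g.app _ x := by
  let z : (X ⊗ Δ[1] : SSet.{v}) _⦋1⦌ := (X.σ 0 x, yonedaEquiv (𝟙 _))
  have h₀ : (ι₀ : X ⟶ _).app _ x = (X ⊗ Δ[1]).δ 1 z := by
    refine Prod.ext ?_ ?_
    · exact (ConcreteCategory.congr_hom (X.δ_comp_σ_succ (i := (0 : Fin 1))) x).symm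
    · ext k
      fin_cases k
      rfl
  have h₁ : (ι₁ : X ⟶ _).app _ x = (X ⊗ Δ[1]).δ 0 z := by
    refine Prod.ext ?_ ?_
    · exact (ConcreteCategory.congr_hom (X.δ_comp_σ_self (i := (0 : Fin 1))) x).symm
    · ext k
      fin_cases k
      rfl
  have e₀ : f.app _ x = H.h.app _ (ι₀.app _ x) :=
    (ConcreteCategory.congr_hom (congr_app H.h₀ _) x).symm
  have e₁ : g.app _ x = H.h.app _ (ι₁.app _ x) :=
    (ConcreteCategory.congr_hom (congr_app H.h₁ _) x).symm
  rw [e₀, e₁, h₀, h₁]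
  exact (NatTrans.naturality_apply H.h (SimplexCategory.δ 1).op z).trans
    (NatTrans.naturality_apply H.h (SimplexCategory.δ 0).op z).symm

/-- Maps to the discrete simplicial set `Prop` are predicates on connected components, and these
are distinguished by their restriction along a weak homotopy equivalence. -/
lemma mapπ₀_surjective_of_isWeakHomotopyEquivalence {X Y : SSet.{v}} {p : X ⟶ Y}
    (hp : IsWeakHomotopyEquivalence p) : Function.Surjective (mapπ₀ p) := by
  intro y
  -- compare the indicator function of the range of `mapπ₀ p` with a constant function
  let g₁ : π₀ Y → ULift.{v} Prop := fun y => ⟨y ∈ Set.range (mapπ₀ p)⟩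
  let g₂ : π₀ Y → ULift.{v} Prop := fun _ => ⟨True⟩
  have h : p ≫ toDiscrete g₁ = p ≫ toDiscrete g₂ := by
    ext n x
    refine congrArg ULift.up (eq_true ⟨π₀.mk (X.map (SimplexCategory.const ⦋0⦌ n.unop 0).op x), ?_⟩)
    rw [mapπ₀_mk]
    exact congrArg π₀.mk (NatTrans.naturality_apply p _ x)
  have h' := (hp (discrete _)).1 (a₁ := Quot.mk _ (toDiscrete g₁))
    (a₂ := Quot.mk _ (toDiscrete g₂)) (congrArg (Quot.mk _) h)
  obtain ⟨y, rfl⟩ := π₀.mk_surjective y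
  let ev : SSetHomotopyClasses Y (discrete (ULift.{v} Prop)) → ULift.{v} Prop :=
    Quot.lift (fun f => f.app _ y) (fun _ _ ⟨H⟩ => app_zero_eq_of_homotopy H y)
  have h'' : (toDiscrete g₁).app _ y = (toDiscrete g₂).app _ y := congrArg ev h'
  rw [toDiscrete_app_zero, toDiscrete_app_zero] at h''
  exact of_eq_true (congrArg ULift.down h'')

end SSet

/-! ### Latching objects -/

section Latching

variable {C : Type u} [Category.{v} C]

/-- An object of the latching category at `n`, from a monomorphism `f : k ⟶ n` which is not an
isomorphism. -/
abbrev LatchingCategory.mk {k n : SimplexCategory} (f : k ⟶ n) (h₁ : Mono f) (h₂ : ¬ IsIso f) :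
    LatchingCategory n :=
  ⟨Over.mk f, h₁, h₂⟩

/-- A morphism of the latching category at `n`, from a factorization of monomorphisms. -/
abbrev LatchingCategory.homMk {n : SimplexCategory} {x y : LatchingCategory n}
    (g : x.obj.left ⟶ y.obj.left) (h : g ≫ y.obj.hom = x.obj.hom) : x ⟶ y :=
  ObjectProperty.homMk (Over.homMk g h)

lemma LatchingCategory.mono {n : SimplexCategory} (x : LatchingCategory n) :
    Mono x.obj.hom := x.property.1

lemma LatchingCategory.len_lt {n : SimplexCategory} (x : LatchingCategory n) :
    x.obj.left.len < n.len := by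
  have := x.mono
  refine lt_of_le_of_ne (SimplexCategory.len_le_of_mono x.obj.hom) fun h => x.property.2 ?_
  obtain ⟨⟨xl, _, xh⟩, hx⟩ := x
  obtain rfl : xl = n := SimplexCategory.ext h
  dsimp at this ⊢
  rw [SimplexCategory.eq_id_of_mono xh]
  exact inferInstanceAs (IsIso (𝟙 xl))

lemma SimplexCategory.not_isIso_image_ι {k n : SimplexCategory} {f : k ⟶ n} (hf : ¬ Epi f) :
    ¬ IsIso (image.ι f) := fun _ => hf (by
  rw [← image.fac f]
  infer_instance)

lemma SimplexCategory.not_epi_comp {l k n : SimplexCategory} (g : l ⟶ k) {f : k ⟶ n}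
    (hf : ¬ Epi f) : ¬ Epi (g ≫ f) := fun _ => hf (epi_of_epi g f)

variable [HasColimits C]

section

variable (X : SimplexCategory ⥤ C)

/-- The canonical map `X^k ⟶ L_n X` attached to an object `[k] ⟶ [n]` of the latching category. -/
def latchingIncl {n : SimplexCategory} (x : LatchingCategory n) :
    X.obj x.obj.left ⟶ colimit (latchingDiagram X n) :=
  colimit.ι (latchingDiagram X n) x

lemma map_comp_latchingIncl {n : SimplexCategory} {x y : LatchingCategory n} (g : x ⟶ y) :
    X.map g.hom.left ≫ latchingIncl X y = latchingIncl X x :=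
  colimit.w (latchingDiagram X n) g

lemma latchingIncl_latchingMap {n : SimplexCategory} (x : LatchingCategory n) :
    latchingIncl X x ≫ latchingMap X n = X.map x.obj.hom :=
  colimit.ι_desc _ _

lemma latchingIncl_hom_ext {n : SimplexCategory} {E : C}
    {a b : colimit (latchingDiagram X n) ⟶ E}
    (h : ∀ x : LatchingCategory n, latchingIncl X x ≫ a = latchingIncl X x ≫ b) : a = b :=
  colimit.hom_ext h

lemma exists_latchingIncl_desc {n : SimplexCategory} {E : C}
    (t : ∀ x : LatchingCategory n, X.obj x.obj.left ⟶ E)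
    (ht : ∀ (x y : LatchingCategory n) (g : x ⟶ y), X.map g.hom.left ≫ t y = t x) :
    ∃ b : colimit (latchingDiagram X n) ⟶ E, ∀ x, latchingIncl X x ≫ b = t x :=
  ⟨colimit.desc (latchingDiagram X n)
    { pt := E
      ι :=
        { app := t
          naturality := fun x y g => (ht x y g).trans (Category.comp_id _).symm } },
    fun _ => colimit.ι_desc _ _⟩

/-- The map `X^k ⟶ L_n X` attached to a map `f : [k] ⟶ [n]` which is not an epimorphism. -/
def latchingι {k n : SimplexCategory} (f : k ⟶ n) (hf : ¬ Epi f) :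
    X.obj k ⟶ colimit (latchingDiagram X n) :=
  X.map (factorThruImage f) ≫ latchingIncl X
    (LatchingCategory.mk (image.ι f) inferInstance (SimplexCategory.not_isIso_image_ι hf))

lemma map_comp_latchingι {l k n : SimplexCategory} (g : l ⟶ k) (f : k ⟶ n) (hf : ¬ Epi f) :
    X.map g ≫ latchingι X f hf = latchingι X (g ≫ f) (SimplexCategory.not_epi_comp g hf) := by
  have h : X.map (image.preComp g f) ≫ _ = _ := map_comp_latchingIncl X
    (LatchingCategory.homMk (x := LatchingCategory.mk (image.ι (g ≫ f)) inferInstance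
        (SimplexCategory.not_isIso_image_ι (SimplexCategory.not_epi_comp g hf)))
      (y := LatchingCategory.mk (image.ι f) inferInstance (SimplexCategory.not_isIso_image_ι hf))
      (image.preComp g f) (image.preComp_ι g f))
  rw [latchingι, latchingι, ← h]
  exact (X.map_comp_assoc _ _ _).symm.trans
    ((congrArg X.map (image.factorThruImage_preComp g f).symm =≫ _).trans (X.map_comp_assoc _ _ _))

lemma latchingι_latchingMap {k n : SimplexCategory} (f : k ⟶ n) (hf : ¬ Epi f) :
    latchingι X f hf ≫ latchingMap X n = X.map f := by
  rw [latchingι, Category.assoc, latchingIncl_latchingMap]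
  dsimp
  rw [← X.map_comp, image.fac]

lemma LatchingCategory.not_epi {n : SimplexCategory} (x : LatchingCategory n) :
    ¬ Epi x.obj.hom := fun _ =>
  have := x.mono
  x.property.2 (isIso_of_mono_of_epi _)

lemma latchingι_eq {n : SimplexCategory} (x : LatchingCategory n) :
    latchingι X x.obj.hom x.not_epi = latchingIncl X x :=
  map_comp_latchingIncl X (LatchingCategory.homMk (x := x)
    (y := LatchingCategory.mk (image.ι x.obj.hom) inferInstance
      (SimplexCategory.not_isIso_image_ι x.not_epi))
    (factorThruImage x.obj.hom) (image.fac _))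

lemma latching_hom_ext {n : SimplexCategory} {E : C}
    {a b : colimit (latchingDiagram X n) ⟶ E}
    (h : ∀ ⦃k : SimplexCategory⦄ (f : k ⟶ n) (hf : ¬ Epi f),
      latchingι X f hf ≫ a = latchingι X f hf ≫ b) : a = b :=
  latchingIncl_hom_ext X fun x => by
    rw [← latchingι_eq]
    exact h _ _

/-- Maps from the latching object `L_n X` are given by compatible families of maps `X^k ⟶ E` for
all the maps `[k] ⟶ [n]` which are not epimorphisms. -/
lemma exists_latching_desc {n : SimplexCategory} {E : C}
    (t : ∀ ⦃k : SimplexCategory⦄ (f : k ⟶ n), ¬ Epi f → (X.obj k ⟶ E))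
    (ht : ∀ ⦃l k : SimplexCategory⦄ (g : l ⟶ k) (f : k ⟶ n) (hf : ¬ Epi f),
      X.map g ≫ t f hf = t (g ≫ f) (SimplexCategory.not_epi_comp g hf)) :
    ∃ b : colimit (latchingDiagram X n) ⟶ E,
      ∀ ⦃k : SimplexCategory⦄ (f : k ⟶ n) (hf : ¬ Epi f), latchingι X f hf ≫ b = t f hf := by
  have ht' {k : SimplexCategory} {f g : k ⟶ n} (h : f = g) (hf : ¬ Epi f) (hg : ¬ Epi g) :
      t f hf = t g hg := by subst h; rfl
  obtain ⟨b, hb⟩ := exists_latchingIncl_desc X (fun x => t x.obj.hom x.not_epi)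
    (fun x y g => (ht _ _ _).trans (ht' (Over.w g.hom) _ _))
  refine ⟨b, fun k f hf => ?_⟩
  rw [latchingι, Category.assoc, hb, ht]
  exact ht' (image.fac f) _ _

end

variable {P Q : SimplexCategory ⥤ C} (φ : P ⟶ Q)

/-- The map `L_n P ⟶ L_n Q` induced by `φ : P ⟶ Q`. -/
def latchingObjMap (n : SimplexCategory) :
    colimit (latchingDiagram P n) ⟶ colimit (latchingDiagram Q n) :=
  colimMap (Functor.whiskerLeft _ (Functor.whiskerLeft _ φ))

lemma latchingIncl_latchingObjMap {n : SimplexCategory} (x : LatchingCategory n) :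
    latchingIncl P x ≫ latchingObjMap φ n =
      φ.app x.obj.left ≫ latchingIncl Q x :=
  ι_colimMap _ _

lemma latchingι_latchingObjMap {k n : SimplexCategory} (f : k ⟶ n) (hf : ¬ Epi f) :
    latchingι P f hf ≫ latchingObjMap φ n = φ.app k ≫ latchingι Q f hf := by
  rw [latchingι, latchingι, Category.assoc, latchingIncl_latchingObjMap]
  exact NatTrans.naturality_assoc φ _ _

lemma latchingObjMap_latchingMap (n : SimplexCategory) :
    latchingObjMap φ n ≫ latchingMap Q n = latchingMap P n ≫ φ.app n :=
  latchingIncl_hom_ext _ fun x => by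
    rw [← Category.assoc, latchingIncl_latchingObjMap, Category.assoc, latchingIncl_latchingMap,
      ← Category.assoc, latchingIncl_latchingMap, NatTrans.naturality]

/-- The lifting property of the relative latching map `P^n ⊔_{L_n P} L_n Q ⟶ Q^n` with respect
to `p`, spelled out without the pushout. -/
def HasRelativeLatchingLift (n : SimplexCategory) {E B : C} (p : E ⟶ B) : Prop :=
  ∀ (a : P.obj n ⟶ E) (b : colimit (latchingDiagram Q n) ⟶ E) (c : Q.obj n ⟶ B),
    latchingMap P n ≫ a = latchingObjMap φ n ≫ b → a ≫ p = φ.app n ≫ c →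
    b ≫ p = latchingMap Q n ≫ c →
    ∃ d : Q.obj n ⟶ E, φ.app n ≫ d = a ∧ latchingMap Q n ≫ d = b ∧ d ≫ p = c

variable {φ}

/-- The inductive step in the construction of lifts for `L_n P ⟶ L_n Q`: compatible lifts on the
objects of the latching category of degree `< j` extend to those of degree `≤ j`. -/
lemma exists_partial_latching_lift {n : SimplexCategory} {E B : C} {p : E ⟶ B}
    (H : ∀ k : SimplexCategory, k.len < n.len → HasRelativeLatchingLift φ k p)
    (a : colimit (latchingDiagram P n) ⟶ E) (c : colimit (latchingDiagram Q n) ⟶ B)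
    (hac : a ≫ p = latchingObjMap φ n ≫ c) (j : ℕ) :
    ∃ d : ∀ x : LatchingCategory n, x.obj.left.len < j → (Q.obj x.obj.left ⟶ E),
      (∀ x hx, φ.app x.obj.left ≫ d x hx = latchingIncl P x ≫ a) ∧
      (∀ x hx, d x hx ≫ p = latchingIncl Q x ≫ c) ∧
      ∀ (x y : LatchingCategory n) (g : x ⟶ y) hx hy, Q.map g.hom.left ≫ d y hy = d x hx := by
  induction j with
  | zero => exact ⟨fun x hx => absurd hx (Nat.not_lt_zero _), by simp, by simp, by simp⟩
  | succ j ih =>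
    obtain ⟨d, hd₁, hd₂, hd₃⟩ := ih
    -- the subobjects `z` of the source of `y`, as objects of the latching category at `n`
    let w (y : LatchingCategory n) (z : LatchingCategory y.obj.left) : LatchingCategory n :=
      LatchingCategory.mk (z.obj.hom ≫ y.obj.hom)
        (have := z.mono; have := y.mono; mono_comp _ _) (fun _ => by
          have h₁ := z.len_lt
          have h₂ := y.len_lt
          have := SimplexCategory.len_le_of_epi (z.obj.hom ≫ y.obj.hom)
          lia)
    let ι (y : LatchingCategory n) (z : LatchingCategory y.obj.left) : w y z ⟶ y :=
      LatchingCategory.homMk z.obj.hom rfl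
    have step (y : LatchingCategory n) (hy : y.obj.left.len = j) :
        ∃ e : Q.obj y.obj.left ⟶ E,
          φ.app y.obj.left ≫ e = latchingIncl P y ≫ a ∧
          e ≫ p = latchingIncl Q y ≫ c ∧
          ∀ z : LatchingCategory y.obj.left,
            Q.map z.obj.hom ≫ e = d (w y z) (hy ▸ z.len_lt) := by
      obtain ⟨b, hb⟩ := exists_latchingIncl_desc Q (n := y.obj.left)
        (fun z => d (w y z) (hy ▸ z.len_lt)) (fun z z' g =>
          hd₃ (w y z) (w y z') (LatchingCategory.homMk g.hom.left (by
            have := Over.w g.hom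
            dsimp [w] at this ⊢
            rw [reassoc_of% this])) _ _)
      obtain ⟨e, he₁, he₂, he₃⟩ := H y.obj.left y.len_lt
        (latchingIncl P y ≫ a) b (latchingIncl Q y ≫ c)
        (latchingIncl_hom_ext _ fun z => by
          rw [← Category.assoc, latchingIncl_latchingMap, ← Category.assoc (latchingIncl _ z),
            latchingIncl_latchingObjMap, Category.assoc, hb]
          refine Eq.trans ?_ (hd₁ (w y z) (hy ▸ z.len_lt)).symm
          rw [← map_comp_latchingIncl P (ι y z), Category.assoc]
          rfl)
        (by rw [Category.assoc, hac, ← Category.assoc, latchingIncl_latchingObjMap, Category.assoc])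
        (latchingIncl_hom_ext _ fun z => by
          rw [← Category.assoc, hb, hd₂, ← Category.assoc, latchingIncl_latchingMap,
            ← map_comp_latchingIncl Q (ι y z), Category.assoc]
          rfl)
      refine ⟨e, he₁, he₃, fun z => ?_⟩
      rw [← latchingIncl_latchingMap, Category.assoc, he₂, hb]
    choose e he₁ he₂ he₃ using step
    refine ⟨fun x hx => if h : x.obj.left.len < j then d x h else
      e x (by lia), fun x hx => ?_, fun x hx => ?_, fun x y g hx hy => ?_⟩
    · dsimp only
      split_ifs
      · exact hd₁ _ _
      · exact he₁ _ _
    · dsimp only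
      split_ifs
      · exact hd₂ _ _
      · exact he₂ _ _
    · dsimp only
      have hg : Mono g.hom.left := by
        have := x.mono
        rw [← Over.w g.hom] at this
        exact mono_of_mono g.hom.left y.obj.hom
      have hxy := SimplexCategory.len_le_of_mono g.hom.left
      by_cases hy' : y.obj.left.len < j
      · rw [dif_pos hy', dif_pos (by lia)]
        exact hd₃ _ _ _ _ _
      · rw [dif_neg hy']
        by_cases hx' : x.obj.left.len < j
        · rw [dif_pos hx']
          let z : LatchingCategory y.obj.left := LatchingCategory.mk g.hom.left hg (fun _ => by
            have := SimplexCategory.len_le_of_epi g.hom.left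
            lia)
          refine (he₃ y (by lia) z).trans ?_
          have := hd₃ x (w y z) (LatchingCategory.homMk (𝟙 _) (by
            dsimp [w, z]
            rw [Category.id_comp]
            exact Over.w g.hom)) hx' hx'
          exact ((Q.map_id _ =≫ _).trans (Category.id_comp _)).symm.trans this
        · rw [dif_neg hx']
          -- a monomorphism between objects of the same degree is an identity
          obtain ⟨⟨xl, ⟨⟨⟩⟩, xh⟩, hx₀⟩ := x
          obtain ⟨⟨yl, ⟨⟨⟩⟩, yh⟩, hy₀⟩ := y
          obtain rfl : xl = yl := SimplexCategory.ext (by dsimp at *; lia)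
          have h₁ : g.hom.left = 𝟙 xl := SimplexCategory.eq_id_of_mono _
          have h₂ := Over.w g.hom
          rw [h₁] at h₂ ⊢
          obtain rfl : yh = xh := by simpa using h₂
          exact (Q.map_id xl =≫ _).trans (Category.id_comp _)

/-- If the relative latching maps of `φ : P ⟶ Q` in degrees `< n` have the left lifting property
with respect to `p`, then so does `L_n P ⟶ L_n Q`. -/
lemma hasLiftingProperty_latchingObjMap {n : SimplexCategory} {E B : C} {p : E ⟶ B}
    (H : ∀ k : SimplexCategory, k.len < n.len → HasRelativeLatchingLift φ k p) :
    HasLiftingProperty (latchingObjMap φ n) p where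
  sq_hasLift {a c} sq := by
    obtain ⟨d, hd₁, hd₂, hd₃⟩ := exists_partial_latching_lift H a c sq.w n.len
    obtain ⟨b, hb⟩ := exists_latchingIncl_desc Q (fun x => d x x.len_lt)
      (fun x y g => hd₃ x y g _ _)
    exact ⟨⟨{
      l := b
      fac_left := latchingIncl_hom_ext _ fun x => by
        rw [← Category.assoc, latchingIncl_latchingObjMap, Category.assoc, hb, hd₁]
      fac_right := latchingIncl_hom_ext _ fun x => by
        rw [← Category.assoc, hb, hd₂] }⟩⟩

end Latching

/-! ### Reedy cofibrations -/

section

variable {C : Type u} [Category.{v} C] [HasColimits C]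
  {P Q : SimplexCategory ⥤ C} (φ : P ⟶ Q)

/-- The relative latching map `P^n ⊔_{L_n P} L_n Q ⟶ Q^n` of `φ : P ⟶ Q`. -/
def relativeLatchingMap (n : SimplexCategory) :
    pushout (latchingMap P n) (latchingObjMap φ n) ⟶ Q.obj n :=
  pushout.desc (φ.app n) (latchingMap Q n) (latchingObjMap_latchingMap φ n).symm

lemma hasRelativeLatchingLift_iff (n : SimplexCategory) {E B : C} (p : E ⟶ B) :
    HasRelativeLatchingLift φ n p ↔ HasLiftingProperty (relativeLatchingMap φ n) p := by
  refine ⟨fun H => ⟨fun {f c} sq => ?_⟩, fun _ a b c hab hac hbc => ?_⟩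
  · have h₁ := pushout.inl (latchingMap P n) (latchingObjMap φ n) ≫= sq.w
    have h₂ := pushout.inr (latchingMap P n) (latchingObjMap φ n) ≫= sq.w
    rw [relativeLatchingMap, pushout.inl_desc_assoc] at h₁
    rw [relativeLatchingMap, pushout.inr_desc_assoc] at h₂
    obtain ⟨d, hd₁, hd₂, hd₃⟩ := H (pushout.inl _ _ ≫ f) (pushout.inr _ _ ≫ f) c
      (pushout.condition_assoc _) (by rw [Category.assoc, h₁]) (by rw [Category.assoc, h₂])
    refine ⟨⟨⟨d, pushout.hom_ext ?_ ?_, hd₃⟩⟩⟩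
    · rw [relativeLatchingMap, pushout.inl_desc_assoc, hd₁]
    · rw [relativeLatchingMap, pushout.inr_desc_assoc, hd₂]
  · have sq : CommSq (pushout.desc a b hab) (relativeLatchingMap φ n) p c := ⟨by
      apply pushout.hom_ext
      · rw [relativeLatchingMap, pushout.inl_desc_assoc, pushout.inl_desc_assoc, hac]
      · rw [relativeLatchingMap, pushout.inr_desc_assoc, pushout.inr_desc_assoc, hbc]⟩
    refine ⟨sq.lift, ?_, ?_, sq.fac_right⟩
    · rw [← pushout.inl_desc (φ.app n) (latchingMap Q n) (latchingObjMap_latchingMap φ n).symm,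
        Category.assoc]
      exact (pushout.inl _ _ ≫= sq.fac_left).trans (pushout.inl_desc _ _ _)
    · rw [← pushout.inr_desc (φ.app n) (latchingMap Q n) (latchingObjMap_latchingMap φ n).symm,
        Category.assoc]
      exact (pushout.inr _ _ ≫= sq.fac_left).trans (pushout.inr_desc _ _ _)

end

namespace LeftSemimodelStructure

variable {C : Type u} [Category.{v} C] [HasLimits C] [HasColimits C]
  {A : LeftSemimodelStructure C}

lemma IsReedyCofibrant.isCofibrant_latchingObj {X : SimplexCategory ⥤ C}
    (hX : A.IsReedyCofibrant X) (n : SimplexCategory) :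
    A.IsCofibrant (colimit (latchingDiagram X n)) := by
  -- apply the lifting lemma for latching objects to `∅ ⟶ X`
  let φ : (Functor.const SimplexCategory).obj (⊥_ C) ⟶ X :=
    { app := fun n => initial.to (X.obj n)
      naturality := fun _ _ _ => initial.hom_ext _ _ }
  rw [IsCofibrant, ← acyclicFib_llp]
  intro E B p hp
  have H (k : SimplexCategory) : HasRelativeLatchingLift φ k p := by
    intro a b c _ _ hbc
    have := A.lift_cof_acyclicFib _ p (hX k) hp
    have sq : CommSq b (latchingMap X k) p c := ⟨hbc⟩
    exact ⟨sq.lift, initial.hom_ext _ _, sq.fac_left, sq.fac_right⟩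
  have := hasLiftingProperty_latchingObjMap (n := n) (fun k _ => H k)
  refine ⟨fun {a c} sq => ?_⟩
  obtain ⟨b, hb⟩ := exists_latchingIncl_desc ((Functor.const SimplexCategory).obj (⊥_ C))
    (n := n) (E := E) (fun _ => initial.to E) (fun _ _ _ => initial.hom_ext _ _)
  have sq' : CommSq b (latchingObjMap φ n) p c :=
    ⟨latchingIncl_hom_ext _ fun x => initial.hom_ext _ _⟩
  exact ⟨⟨⟨sq'.lift, initial.hom_ext _ _, sq'.fac_right⟩⟩⟩

lemma IsReedyCofibrant.isCofibrant {X : SimplexCategory ⥤ C}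
    (hX : A.IsReedyCofibrant X) (n : SimplexCategory) : A.IsCofibrant (X.obj n) :=
  (hX.isCofibrant_latchingObj n).of_cof (hX n)

/-- The map `φ` is a Reedy cofibration: its relative latching maps are cofibrations, i.e. have the
left lifting property with respect to acyclic fibrations. -/
def IsReedyCofibration (A : LeftSemimodelStructure C) {P Q : SimplexCategory ⥤ C} (φ : P ⟶ Q) :
    Prop :=
  ∀ (n : SimplexCategory) ⦃E B : C⦄ (p : E ⟶ B), A.acyclicFib p → HasRelativeLatchingLift φ n p

/-- The relative latching maps of a Reedy cofibration which is a levelwise weak equivalence and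
has a Reedy cofibrant source are acyclic cofibrations. -/
lemma IsReedyCofibration.hasRelativeLatchingLift {P Q : SimplexCategory ⥤ C} {φ : P ⟶ Q}
    (hφ : A.IsReedyCofibration φ) (hP : A.IsReedyCofibrant P)
    (hw : ∀ n, A.weq (φ.app n)) (n : SimplexCategory) ⦃E B : C⦄ (p : E ⟶ B) (hp : A.fib p) :
    HasRelativeLatchingLift φ n p := by
  obtain ⟨m, hm⟩ : ∃ m, m = n.len := ⟨_, rfl⟩
  induction m using Nat.strong_induction_on generalizing n E B p with
  | _ m ih =>
    subst hm
    rw [hasRelativeLatchingLift_iff]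
    have hL : A.acyclicCof (latchingObjMap φ n) :=
      acyclicCof_of_llp_fib (hP.isCofibrant_latchingObj n) (fun _ _ q hq =>
        hasLiftingProperty_latchingObjMap (fun k hk => ih _ hk k q hq rfl))
    have hinl : A.acyclicCof (pushout.inl (latchingMap P n) (latchingObjMap φ n)) :=
      acyclicCof_of_isPushout (IsPushout.of_hasPushout _ _) hL
        (hP.isCofibrant_latchingObj n) (hP.isCofibrant n)
    refine A.lift_acyclicCof_fib _ _ ((hP.isCofibrant n).of_cof hinl.1) ⟨?_, ?_⟩ hp
    · rw [← acyclicFib_llp]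
      exact fun _ _ q hq => (hasRelativeLatchingLift_iff φ n q).1 (hφ n q hq)
    · refine A.weq_of_precomp hinl.2 ?_
      rw [relativeLatchingMap, pushout.inl_desc]
      exact hw n

/-- A Reedy cofibration which is a levelwise weak equivalence and has a Reedy cofibrant source
induces a weak homotopy equivalence (even an acyclic Kan fibration) on the simplicial sets of
maps to a fibrant object. -/
lemma IsReedyCofibration.isWeakHomotopyEquivalence {P Q : SimplexCategory ⥤ C} {φ : P ⟶ Q}
    (hφ : A.IsReedyCofibration φ) (hP : A.IsReedyCofibrant P)
    (hw : ∀ n, A.weq (φ.app n)) {Z : C} (hZ : A.IsFibrant Z) :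
    IsWeakHomotopyEquivalence (cosimplicialHomMap φ Z) := by
  apply SSet.isWeakHomotopyEquivalence_of_rlp
  rintro _ _ _ ⟨n⟩
  refine ⟨fun {β α} sq => ?_⟩
  -- `β` and `α` amount to maps `L_n Q ⟶ Z` and `P^n ⟶ Z`
  have hmem {k : SimplexCategory} (f : k ⟶ ⦋n⦌) (hf : ¬ Epi f) :
      SSet.stdSimplex.objEquiv.{v}.symm f ∈ (SSet.boundary.{v} n).obj (Opposite.op k) :=
    fun h => hf (SimplexCategory.epi_iff_surjective.2 h)
  let t ⦃k : SimplexCategory⦄ (f : k ⟶ ⦋n⦌) (hf : ¬ Epi f) : Q.obj k ⟶ Z :=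
    β.app (Opposite.op k) ⟨_, hmem f hf⟩
  obtain ⟨b, hb⟩ := exists_latching_desc Q t (fun l k g f hf =>
    (NatTrans.naturality_apply β g.op ⟨_, hmem f hf⟩).symm)
  let a : P.obj ⦋n⦌ ⟶ Z := SSet.yonedaEquiv α
  have ha {k : SimplexCategory} (f : k ⟶ ⦋n⦌) :
      α.app (Opposite.op k) (SSet.stdSimplex.objEquiv.{v}.symm f) = P.map f ≫ a := by
    obtain ⟨a', rfl⟩ := SSet.yonedaEquiv.symm.surjective α
    simp only [a, Equiv.apply_symm_apply]
    rfl
  obtain ⟨d, hd₁, hd₂, -⟩ := hφ.hasRelativeLatchingLift hP hw ⦋n⦌ (terminal.from Z) hZ a b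
    (terminal.from _) (latching_hom_ext _ fun k f hf => by
      have h := ConcreteCategory.congr_hom (congr_app sq.w (Opposite.op k)) ⟨_, hmem f hf⟩
      rw [← Category.assoc, latchingι_latchingMap, ← Category.assoc, latchingι_latchingObjMap,
        Category.assoc, hb, ← ha]
      exact h.symm) (by subsingleton) (by subsingleton)
  let δ : Δ[n] ⟶ cosimplicialHom Q Z := SSet.yonedaEquiv.symm d
  have hδ {k : SimplexCategory} (f : k ⟶ ⦋n⦌) :
      δ.app (Opposite.op k) (SSet.stdSimplex.objEquiv.{v}.symm f) = Q.map f ≫ d := rfl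
  refine ⟨⟨⟨δ, ?_, ?_⟩⟩⟩
  · ext ⟨k⟩ ⟨f, hf⟩
    obtain ⟨f, rfl⟩ := SSet.stdSimplex.objEquiv.symm.surjective f
    have hf' : ¬ Epi f := fun h => hf (SimplexCategory.epi_iff_surjective.1 h)
    change δ.app (Opposite.op k) (SSet.stdSimplex.objEquiv.{v}.symm f) = t f hf'
    rw [hδ, ← hb, ← latchingι_latchingMap Q f hf', Category.assoc, hd₂]
  · exact (SSet.yonedaEquiv_symm_comp _ _).trans ((Equiv.symm_apply_eq _).2 hd₁)

end LeftSemimodelStructure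

namespace LeftSemimodelStructure

variable {C : Type u} [Category.{v} C] [HasLimits C] [HasColimits C]
  {A : LeftSemimodelStructure C}

/-! ### Extensions along maps inducing equivalences on mapping spaces -/

/-- An edge of `Hom(X^•, Z)` is a homotopy between two maps `X^0 ⟶ Z`, to which the homotopy
extension property applies. -/
lemma CosimplicialResolution.exists_extension_iff_of_edge {K N Z : C}
    (R : A.CosimplicialResolution K) (hZ : A.IsFibrant Z) {x : R.obj.obj ⦋0⦌ ⟶ N} (hx : A.cof x)
    {b₀ b₁ : (cosimplicialHom R.obj Z) _⦋0⦌} (e : SSet.Edge b₀ b₁) :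
    (∃ m : N ⟶ Z, x ≫ m = b₀) ↔ (∃ m : N ⟶ Z, x ≫ m = b₁) := by
  have hσ : A.weq (R.obj.map (SimplexCategory.σ (0 : Fin 1))) := by
    refine A.weq_of_postcomp (R.weq_π _) ?_
    rw [R.π.naturality]
    dsimp
    rw [Category.comp_id]
    exact R.weq_π _
  have h₀ : R.obj.map (SimplexCategory.δ (1 : Fin 2)) ≫ R.obj.map (SimplexCategory.σ (0 : Fin 1)) =
      𝟙 _ := by
    rw [← R.obj.map_comp, ← R.obj.map_id]
    exact congrArg R.obj.map SimplexCategory.δ_comp_σ_succ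
  have h₁ : R.obj.map (SimplexCategory.δ (0 : Fin 2)) ≫ R.obj.map (SimplexCategory.σ (0 : Fin 1)) =
      𝟙 _ := by
    rw [← R.obj.map_comp, ← R.obj.map_id]
    exact congrArg R.obj.map SimplexCategory.δ_comp_σ_self
  have hs : R.obj.map (SimplexCategory.δ (1 : Fin 2)) ≫ e.edge = b₀ := e.src_eq
  have ht : R.obj.map (SimplexCategory.δ (0 : Fin 2)) ≫ e.edge = b₁ := e.tgt_eq
  constructor
  · rintro ⟨m, hm⟩
    rw [← ht]
    exact exists_homotopy_extension hx (R.reedyCofibrant.isCofibrant _) hZ hσ h₀ h₁ e.edge m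
      (hs.trans hm.symm)
  · rintro ⟨m, hm⟩
    rw [← hs]
    exact exists_homotopy_extension hx (R.reedyCofibrant.isCofibrant _) hZ hσ h₁ h₀ e.edge m
      (ht.trans hm.symm)

/-- If the cofibration `j : K ⟶ L` with cofibrant source induces a weak homotopy equivalence
`map(L, Z) ⟶ map(K, Z)`, then any map `K ⟶ Z` extends to `L`. Only the surjectivity on connected
components is used, together with the homotopy extension property. -/
lemma InducesEquivalenceOnMap.exists_extension {K L Z : C} {j : K ⟶ L}
    (h : A.InducesEquivalenceOnMap j Z) (hj : A.cof j) (hK : A.IsCofibrant K)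
    (hZ : A.IsFibrant Z) (k : K ⟶ Z) : ∃ l : L ⟶ Z, j ≫ l = k := by
  obtain ⟨RK, RL, φ, hφ, hw⟩ := h
  have hL := hK.of_cof hj
  have hX := RK.reedyCofibrant.isCofibrant ⦋0⦌
  have hM := RL.reedyCofibrant.isCofibrant ⦋0⦌
  have hφ₀ : φ.app ⦋0⦌ ≫ RL.π.app ⦋0⦌ = RK.π.app ⦋0⦌ ≫ j := congr_app hφ ⦋0⦌
  -- `N` is an object weakly equivalent to `L`, with a cofibration from `RK^0` over `j`
  obtain ⟨K', i, s, r, hi, hs, hir, hsr⟩ :=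
    exists_brown_factorization (w := RK.π.app ⦋0⦌) hX hK (RK.weq_π _)
  let N := pushout s j
  have hN₁ : A.cof (pushout.inl s j) := A.cof_of_isPushout (IsPushout.of_hasPushout _ _) hj
  have hN₂ : A.acyclicCof (pushout.inr s j) :=
    acyclicCof_of_isPushout (IsPushout.of_hasPushout s j).flip hs hK hL
  let x : RK.obj.obj ⦋0⦌ ⟶ N := i ≫ pushout.inl s j
  have hx : A.cof x := A.cof_comp hi.1 hN₁
  let ρ : N ⟶ L := pushout.desc (r ≫ j) (𝟙 L) (by rw [reassoc_of% hsr, Category.comp_id])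
  have hxρ : φ.app ⦋0⦌ ≫ RL.π.app ⦋0⦌ = x ≫ ρ := by
    simp only [x, ρ]
    rw [Category.assoc, pushout.inl_desc, reassoc_of% hir, hφ₀]
  -- up to homotopy, the map `RK^0 ⟶ K ⟶ Z` extends to `RL^0`; it does extend to `N`
  have hext (h : RL.obj.obj ⦋0⦌ ⟶ Z) : ∃ m : N ⟶ Z, x ≫ m = φ.app ⦋0⦌ ≫ h := by
    obtain ⟨M', q, p, hq, hp, fac⟩ :=
      A.exists_cof_acyclicFib (pushout.desc (RL.π.app ⦋0⦌) ρ hxρ)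
    have hM' : A.acyclicCof (pushout.inl (φ.app ⦋0⦌) x ≫ q) := by
      refine ⟨A.cof_comp (A.cof_of_isPushout (IsPushout.of_hasPushout _ _) hx) hq,
        A.weq_of_postcomp hp.2 ?_⟩
      rw [Category.assoc, fac, pushout.inl_desc]
      exact RL.weq_π _
    obtain ⟨m, hm⟩ := LeftSemimodelStructure.exists_extension hM hM' hZ h
    refine ⟨pushout.inr (φ.app ⦋0⦌) x ≫ q ≫ m, ?_⟩
    rw [← pushout.condition_assoc, ← hm, Category.assoc]
  obtain ⟨m, hm⟩ : ∃ m : N ⟶ Z, x ≫ m = RK.π.app ⦋0⦌ ≫ k := by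
    let b : (cosimplicialHom RK.obj Z) _⦋0⦌ := RK.π.app ⦋0⦌ ≫ k
    obtain ⟨y, hy⟩ := SSet.mapπ₀_surjective_of_isWeakHomotopyEquivalence hw (SSet.π₀.mk b)
    obtain ⟨h, rfl⟩ := SSet.π₀.mk_surjective y
    rw [SSet.mapπ₀_mk, SSet.π₀.mk_eq_mk_iff] at hy
    have key : ∀ {b₀ b₁ : (cosimplicialHom RK.obj Z) _⦋0⦌}, Relation.EqvGen SSet.π₀Rel b₀ b₁ →
        ((∃ m : N ⟶ Z, x ≫ m = b₀) ↔ (∃ m : N ⟶ Z, x ≫ m = b₁)) := by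
      intro b₀ b₁ H
      induction H with
      | rel _ _ H => exact RK.exists_extension_iff_of_edge hZ hx H.some
      | refl => rfl
      | symm _ _ _ H => exact H.symm
      | trans _ _ _ _ _ H₁ H₂ => exact H₁.trans H₂
    exact (key hy).1 (hext h)
  -- the restriction of `m` to `K'` and the map `K' ⟶ K ⟶ Z` agree on `RK^0`,
  -- hence are homotopic on `K'`
  obtain ⟨D, q, p, hq, hp, fac⟩ :=
    A.exists_cof_acyclicFib (pushout.desc (f := i) (g := i) (𝟙 K') (𝟙 K') rfl)
  have hK' := hX.of_cof hi.1
  have hinl : A.acyclicCof (pushout.inl i i) :=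
    acyclicCof_of_isPushout (IsPushout.of_hasPushout _ _) hi hX hK'
  have hinl_p : pushout.inl i i ≫ q ≫ p = 𝟙 K' := by rw [fac, pushout.inl_desc]
  have hinr_p : pushout.inr i i ≫ q ≫ p = 𝟙 K' := by rw [fac, pushout.inr_desc]
  have hq' : A.acyclicCof q := by
    refine ⟨hq, A.weq_of_precomp hinl.2 (A.weq_of_postcomp hp.2 ?_)⟩
    rw [Category.assoc, hinl_p]
    exact A.weq_id _
  obtain ⟨e, he⟩ := LeftSemimodelStructure.exists_extension (hK'.of_cof hinl.1) hq' hZ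
    (pushout.desc (pushout.inl s j ≫ m) (r ≫ k) (by
      rw [← Category.assoc, hm, reassoc_of% hir]))
  -- the restriction of this homotopy to `K`
  have hσ : A.acyclicFib (pullback.snd p s) :=
    A.acyclicFib_pullback.of_isPullback (IsPullback.of_hasPullback p s) hp
  let i₀ : K ⟶ pullback p s := pullback.lift (s ≫ pushout.inl i i ≫ q) (𝟙 K) (by
    simp only [Category.assoc, Category.id_comp]
    rw [hinl_p, Category.comp_id])
  let i₁ : K ⟶ pullback p s := pullback.lift (s ≫ pushout.inr i i ≫ q) (𝟙 K) (by
    simp only [Category.assoc, Category.id_comp]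
    rw [hinr_p, Category.comp_id])
  obtain ⟨l, hl⟩ := exists_homotopy_extension hj hK hZ hσ.2
    (i₀ := i₀) (i₁ := i₁) (pullback.lift_snd _ _ _) (pullback.lift_snd _ _ _)
    (pullback.fst p s ≫ e) (pushout.inr s j ≫ m) (by
      simp only [i₀]
      rw [pullback.lift_fst_assoc, Category.assoc, Category.assoc, he, pushout.inl_desc,
        pushout.condition_assoc])
  refine ⟨l, hl.trans ?_⟩
  simp only [i₁]
  rw [pullback.lift_fst_assoc, Category.assoc, Category.assoc, he, pushout.inr_desc,
    reassoc_of% hsr]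

end LeftSemimodelStructure

/-! ### Left Quillen functors -/

namespace IsQuillenPair

variable {M : Type u₁} [Category.{v} M] [HasLimits M] [HasColimits M]
  {N : Type u₂} [Category.{v} N] [HasLimits N] [HasColimits N]
  {F : M ⥤ N} {U : N ⥤ M} {adj : F ⊣ U}
  {A : LeftSemimodelStructure M} {B : LeftSemimodelStructure N} (h : IsQuillenPair adj A B)

include h

lemma map_cof {X Y : M} {i : X ⟶ Y} (hi : A.cof i) : B.cof (F.map i) := by
  rw [← LeftSemimodelStructure.acyclicFib_llp]
  intro _ _ p hp
  rw [adj.hasLiftingProperty_iff]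
  exact A.lift_cof_acyclicFib _ _ hi (h.map_acyclicFib p hp)

lemma map_isCofibrant {X : M} (hX : A.IsCofibrant X) : B.IsCofibrant (F.obj X) := by
  have hF : IsInitial (F.obj (⊥_ M)) :=
    have := adj.isLeftAdjoint
    IsInitial.isInitialObj F _ initialIsInitial
  have h' := h.map_cof hX
  have : initial.to (F.obj X) =
      (initialIsInitial.uniqueUpToIso hF).hom ≫ F.map (initial.to X) := by subsingleton
  rw [LeftSemimodelStructure.IsCofibrant, this]
  refine B.cof_comp ?_ h'
  rw [← LeftSemimodelStructure.acyclicFib_llp]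
  exact MorphismProperty.llp_of_isIso _ _

lemma map_acyclicCof {X Y : M} {i : X ⟶ Y} (hX : A.IsCofibrant X) (hi : A.acyclicCof i) :
    B.acyclicCof (F.map i) := by
  refine LeftSemimodelStructure.acyclicCof_of_llp_fib (h.map_isCofibrant hX) fun _ _ p hp => ?_
  rw [adj.hasLiftingProperty_iff]
  exact A.lift_acyclicCof_fib _ _ hX hi (h.map_fib p hp)

/-- Ken Brown's lemma. -/
lemma map_weq {X Y : M} {w : X ⟶ Y} (hX : A.IsCofibrant X) (hY : A.IsCofibrant Y)
    (hw : A.weq w) : B.weq (F.map w) := by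
  obtain ⟨Z, i, s, r, hi, hs, hir, hsr⟩ :=
    LeftSemimodelStructure.exists_brown_factorization hX hY hw
  rw [← hir, F.map_comp]
  refine B.weq_comp (h.map_acyclicCof hX hi).2 (B.weq_of_precomp (h.map_acyclicCof hY hs).2 ?_)
  rw [← F.map_comp, hsr, F.map_id]
  exact B.weq_id _

lemma map_isReedyCofibrant {X : SimplexCategory ⥤ M} (hX : A.IsReedyCofibrant X) :
    B.IsReedyCofibrant (X ⋙ F) := by
  intro n
  have hn := h.map_cof (hX n)
  have := adj.isLeftAdjoint
  have : PreservesColimitsOfShape (LatchingCategory n) F :=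
    have := preservesColimitsOfSize_shrink.{0, 0, v, v} F
    inferInstance
  have e : latchingMap (X ⋙ F) n =
      (preservesColimitIso F (latchingDiagram X n)).inv ≫ F.map (latchingMap X n) := by
    refine latchingIncl_hom_ext _ fun x => ?_
    rw [latchingIncl_latchingMap]
    have hx : latchingIncl (X ⋙ F) x ≫ (preservesColimitIso F (latchingDiagram X n)).inv =
        F.map (latchingIncl X x) := ι_preservesColimitIso_inv F (latchingDiagram X n) x
    refine Eq.trans ?_ ((hx =≫ F.map (latchingMap X n)).symm.trans (Category.assoc _ _ _))
    exact (congrArg F.map (latchingIncl_latchingMap X x).symm).trans (F.map_comp _ _)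
  rw [e]
  refine B.cof_comp ?_ hn
  rw [← LeftSemimodelStructure.acyclicFib_llp]
  exact MorphismProperty.llp_of_isIso _ _

/-- The image of a cosimplicial resolution of a cofibrant object under the left adjoint. -/
def mapCosimplicialResolution {X : M} (hX : A.IsCofibrant X) (R : A.CosimplicialResolution X) :
    B.CosimplicialResolution (F.obj X) where
  obj := R.obj ⋙ F
  π := { app := fun n => F.map (R.π.app n)
         naturality := fun m n f => by
          dsimp
          rw [← F.map_comp, R.π.naturality]
          dsimp
          rw [Category.comp_id, Category.comp_id] }
  reedyCofibrant := h.map_isReedyCofibrant R.reedyCofibrant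
  weq_π n := h.map_weq (R.reedyCofibrant.isCofibrant n) hX (R.weq_π n)

/-- By adjunction, `map(F f, Z)` identifies to `map(f, U Z)`. -/
lemma inducesEquivalenceOnMap_map {X Y : M} {f : X ⟶ Y} (hX : A.IsCofibrant X)
    (hY : A.IsCofibrant Y) {Z : N} (hf : A.InducesEquivalenceOnMap f (U.obj Z)) :
    B.InducesEquivalenceOnMap (F.map f) Z := by
  obtain ⟨RX, RY, φ, hφ, hw⟩ := hf
  let e (R : SimplexCategory ⥤ M) : cosimplicialHom R (U.obj Z) ≅ cosimplicialHom (R ⋙ F) Z :=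
    NatIso.ofComponents (fun n => (adj.homEquiv (R.obj n.unop) Z).symm.toIso) (fun θ => by
      ext a
      exact adj.homEquiv_naturality_left_symm _ _)
  refine ⟨h.mapCosimplicialResolution hX RX, h.mapCosimplicialResolution hY RY,
    Functor.whiskerRight φ F, ?_, hw.of_iso (e RY.obj) (e RX.obj) ?_⟩
  · ext n
    have := congr_app hφ n
    dsimp [mapCosimplicialResolution] at this ⊢
    rw [← F.map_comp, this, F.map_comp]
  · ext n a
    exact adj.homEquiv_naturality_left_symm _ _

end IsQuillenPair

/-! ### Cofree functors on sieves -/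

namespace CategoryTheory.Sieve

variable {C : Type u} [Category.{v} C] [HasLimits C] {J : Type} [SmallCategory J] {n : J}

lemma hasProductsOfShape_of_hasLimits (T : Type) : HasProductsOfShape T C :=
  have := hasLimitsOfSizeShrink.{0, 0, v, v} C
  inferInstance

attribute [local instance] hasProductsOfShape_of_hasLimits

/-- The functor `m ↦ ∏ E`, where the product is indexed by the maps `m ⟶ n` in the sieve `S`. For
the maximal sieve, this is the right adjoint of the evaluation at `n`, applied to `E`. -/
def cofree (S : Sieve n) (E : C) : J ⥤ C where
  obj m := ∏ᶜ fun _ : { u : m ⟶ n // S u } => E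
  map g := Pi.lift fun u => Pi.π _ ⟨g ≫ u.1, S.downward_closed u.2 g⟩
  map_id m := Pi.hom_ext _ _ fun u => by
    rw [Pi.lift_π]
    exact (congrArg (fun v : { u : m ⟶ n // S u } => Pi.π (fun _ => E) v)
      (Subtype.ext (Category.id_comp _))).trans (Category.id_comp _).symm
  map_comp {k _ _} f g := Pi.hom_ext _ _ fun u => by
    rw [Category.assoc, Pi.lift_π, Pi.lift_π, Pi.lift_π]
    exact congrArg (fun v : { u : k ⟶ n // S u } => Pi.π (fun _ => E) v)
      (Subtype.ext (Category.assoc _ _ _))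

/-- The projections from the values of `S.cofree E`. -/
def cofreeπ (S : Sieve n) (E : C) {m : J} (u : m ⟶ n) (hu : S u) : (S.cofree E).obj m ⟶ E :=
  Pi.π (fun _ : { u : m ⟶ n // S u } => E) ⟨u, hu⟩

lemma map_cofreeπ (S : Sieve n) (E : C) {l m : J} (g : l ⟶ m) (u : m ⟶ n) (hu : S u) :
    (S.cofree E).map g ≫ S.cofreeπ E u hu = S.cofreeπ E (g ≫ u) (S.downward_closed hu g) :=
  Pi.lift_π _ _

lemma cofree_hom_ext {S : Sieve n} {E K : C} {m : J} {a b : K ⟶ (S.cofree E).obj m}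
    (h : ∀ (u : m ⟶ n) (hu : S u), a ≫ S.cofreeπ E u hu = b ≫ S.cofreeπ E u hu) : a = b :=
  Pi.hom_ext _ _ fun u => h u.1 u.2

lemma exists_cofree_lift (S : Sieve n) {E K : C} {m : J} (t : ∀ u : m ⟶ n, S u → (K ⟶ E)) :
    ∃ l : K ⟶ (S.cofree E).obj m, ∀ (u : m ⟶ n) (hu : S u), l ≫ S.cofreeπ E u hu = t u hu :=
  ⟨Pi.lift fun u => t u.1 u.2, fun _ _ => Pi.lift_π _ _⟩

/-- Maps to `S.cofree E` are given by compatible families of maps to `E`, indexed by `S`. -/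
lemma exists_cofree_natTrans (S : Sieve n) {E : C} {X : J ⥤ C}
    (t : ∀ ⦃m : J⦄ (u : m ⟶ n), S u → (X.obj m ⟶ E))
    (ht : ∀ ⦃l m : J⦄ (g : l ⟶ m) (u : m ⟶ n) (hu : S u),
      X.map g ≫ t u hu = t (g ≫ u) (S.downward_closed hu g)) :
    ∃ f : X ⟶ S.cofree E,
      ∀ ⦃m : J⦄ (u : m ⟶ n) (hu : S u), f.app m ≫ S.cofreeπ E u hu = t u hu := by
  choose l hl using fun m => S.exists_cofree_lift (m := m) (@t m)
  refine ⟨⟨l, fun m m' g => cofree_hom_ext fun u hu => ?_⟩, hl⟩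
  rw [Category.assoc, Category.assoc, hl, map_cofreeπ, hl, ht]

/-- The functoriality of `S.cofree E` in `S` and `E`. -/
def cofreeMap {S S' : Sieve n} (h : S' ≤ S) {E B : C} (p : E ⟶ B) : S.cofree E ⟶ S'.cofree B :=
  (S'.exists_cofree_natTrans (fun _ u hu => S.cofreeπ E u (h _ hu) ≫ p)
    (fun _ _ g u hu => by rw [← Category.assoc, map_cofreeπ])).choose

lemma cofreeMap_cofreeπ {S S' : Sieve n} (h : S' ≤ S) {E B : C} (p : E ⟶ B) {m : J} (u : m ⟶ n)
    (hu : S' u) :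
    (cofreeMap h p).app m ≫ S'.cofreeπ B u hu = S.cofreeπ E u (h _ hu) ≫ p :=
  (S'.exists_cofree_natTrans (fun _ u hu => S.cofreeπ E u (h _ hu) ≫ p)
    (fun _ _ g u hu => by rw [← Category.assoc, map_cofreeπ])).choose_spec u hu

end CategoryTheory.Sieve

/-! ### Projective cofibrations are Reedy cofibrations -/

/-- The maps to `[n]` in the simplex category which are not epimorphisms. -/
def SimplexCategory.nonEpi (n : SimplexCategory) : Sieve n where
  arrows _ f := ¬ Epi f
  downward_closed hf g := SimplexCategory.not_epi_comp g hf

namespace LeftSemimodelStructure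

variable {C : Type u} [Category.{v} C] [HasLimits C] [HasColimits C]
  {A : LeftSemimodelStructure C}

/-- The levelwise acyclic fibrations between cosimplicial objects: the acyclic fibrations of the
projective structure. The maps with the left lifting property with respect to these are the
projective cofibrations. -/
def levelwiseAcyclicFib (A : LeftSemimodelStructure C) : MorphismProperty (SimplexCategory ⥤ C) :=
  fun _ _ f => ∀ n, A.acyclicFib (f.app n)

/-- Projective cofibrations are Reedy cofibrations. To solve a lifting problem for the relative
latching map at `[n]`, transpose it to a lifting problem against the levelwise acyclic fibration
comparing the cofree cosimplicial objects on all the maps to `[n]` and on those which are not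
epimorphisms. -/
lemma isReedyCofibration_of_llp {P Q : SimplexCategory ⥤ C} {φ : P ⟶ Q}
    (hφ : A.levelwiseAcyclicFib.llp φ) : A.IsReedyCofibration φ := by
  intro n E B p hp a b c hab hac hbc
  let S := n.nonEpi
  have hS {m : SimplexCategory} {u : m ⟶ n} (hu : S u) : ¬ Epi u := hu
  let r (Z : C) : (⊤ : Sieve n).cofree Z ⟶ S.cofree Z := Sieve.cofreeMap le_top (𝟙 Z)
  have hr (Z : C) {m : SimplexCategory} (u : m ⟶ n) (hu : S u) :
      (r Z).app m ≫ S.cofreeπ Z u hu = (⊤ : Sieve n).cofreeπ Z u trivial :=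
    (Sieve.cofreeMap_cofreeπ _ _ _ _).trans (Category.comp_id _)
  let p' : S.cofree E ⟶ S.cofree B := Sieve.cofreeMap le_rfl p
  let p'' : (⊤ : Sieve n).cofree E ⟶ (⊤ : Sieve n).cofree B := Sieve.cofreeMap le_rfl p
  have hp' {m : SimplexCategory} (u : m ⟶ n) (hu : S u) :
      p'.app m ≫ S.cofreeπ B u hu = S.cofreeπ E u hu ≫ p := Sieve.cofreeMap_cofreeπ _ _ _ _
  have hp'' {m : SimplexCategory} (u : m ⟶ n) :
      p''.app m ≫ (⊤ : Sieve n).cofreeπ B u trivial = (⊤ : Sieve n).cofreeπ E u trivial ≫ p :=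
    Sieve.cofreeMap_cofreeπ _ _ _ _
  let q : (⊤ : Sieve n).cofree E ⟶ pullback p' (r B) := pullback.lift (r E) p'' (by
    ext m
    refine Sieve.cofree_hom_ext fun u hu => ?_
    rw [NatTrans.comp_app, NatTrans.comp_app, Category.assoc, Category.assoc, hp', hr,
      ← Category.assoc, hr, hp''])
  have hq : A.levelwiseAcyclicFib q := by
    intro m
    rw [← cof_rlp]
    intro K L i hi
    have := A.lift_cof_acyclicFib i p hi hp
    refine ⟨fun {f g} sq => ?_⟩
    have h₁ : q.app m ≫ (pullback.fst p' (r B)).app m = (r E).app m :=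
      congr_app (pullback.lift_fst (f := p') (g := r B) _ _ _) m
    have h₂ : q.app m ≫ (pullback.snd p' (r B)).app m = p''.app m :=
      congr_app (pullback.lift_snd (f := p') (g := r B) _ _ _) m
    have hlift (u : m ⟶ n) : ∃ l : L ⟶ E, i ≫ l = f ≫ (⊤ : Sieve n).cofreeπ E u trivial ∧
        l ≫ p = g ≫ (pullback.snd p' (r B)).app m ≫ (⊤ : Sieve n).cofreeπ B u trivial ∧
        ∀ hu : S u, l = g ≫ (pullback.fst p' (r B)).app m ≫ S.cofreeπ E u hu := by
      by_cases hu : S u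
      · refine ⟨g ≫ (pullback.fst p' (r B)).app m ≫ S.cofreeπ E u hu, ?_, ?_, fun _ => rfl⟩
        · rw [← reassoc_of% sq.w, reassoc_of% h₁, hr]
        · rw [Category.assoc, Category.assoc, ← hp', ← hr B u hu]
          have h := congr_app (pullback.condition (f := p') (g := r B)) m
          rw [NatTrans.comp_app, NatTrans.comp_app] at h
          rw [reassoc_of% h]
      · have sq' : CommSq (f ≫ (⊤ : Sieve n).cofreeπ E u trivial) i p
            (g ≫ (pullback.snd p' (r B)).app m ≫ (⊤ : Sieve n).cofreeπ B u trivial) := ⟨by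
          rw [Category.assoc, ← hp'', ← reassoc_of% sq.w, reassoc_of% h₂]⟩
        exact ⟨sq'.lift, sq'.fac_left, sq'.fac_right, fun h => absurd h hu⟩
    choose l hl₁ hl₂ hl₃ using hlift
    obtain ⟨l', hl'⟩ := (⊤ : Sieve n).exists_cofree_lift (m := m) (fun u _ => l u)
    refine ⟨⟨⟨l', Sieve.cofree_hom_ext fun u _ => ?_, ?_⟩⟩⟩
    · rw [Category.assoc, hl', hl₁]
    · apply ((IsPullback.of_hasPullback p' (r B)).map
        ((evaluation SimplexCategory C).obj m)).hom_ext
      · refine Sieve.cofree_hom_ext fun u hu => ?_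
        have : (l' ≫ (r E).app m) ≫ S.cofreeπ E u hu = l u := by
          rw [Category.assoc, hr, hl']
        rw [hl₃ u hu, ← h₁] at this
        simpa using this
      · refine Sieve.cofree_hom_ext fun u _ => ?_
        have : (l' ≫ p''.app m) ≫ (⊤ : Sieve n).cofreeπ B u trivial = l u ≫ p := by
          rw [Category.assoc, hp'', reassoc_of% hl']
        rw [hl₂ u, ← h₂] at this
        simpa using this
  have := hφ q hq
  obtain ⟨α, hα⟩ := (⊤ : Sieve n).exists_cofree_natTrans (X := P) (fun m u _ => P.map u ≫ a)
    (fun l m g u _ => by rw [P.map_comp_assoc])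
  obtain ⟨γ, hγ⟩ := (⊤ : Sieve n).exists_cofree_natTrans (X := Q) (fun m u _ => Q.map u ≫ c)
    (fun l m g u _ => by rw [Q.map_comp_assoc])
  obtain ⟨β, hβ⟩ := S.exists_cofree_natTrans (X := Q) (fun m u hu => latchingι Q u (hS hu) ≫ b)
    (fun l m g u hu => by rw [← Category.assoc, map_comp_latchingι])
  have sq : CommSq α φ q (pullback.lift β γ (by
      ext m
      refine Sieve.cofree_hom_ext fun u hu => ?_
      rw [NatTrans.comp_app, NatTrans.comp_app, Category.assoc, Category.assoc, hp', hr, hγ,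
        ← Category.assoc, hβ, Category.assoc, hbc, ← Category.assoc, latchingι_latchingMap])) := ⟨by
    apply pullback.hom_ext
    · ext m
      refine Sieve.cofree_hom_ext fun u hu => ?_
      rw [Category.assoc, Category.assoc, pullback.lift_fst, pullback.lift_fst, NatTrans.comp_app,
        NatTrans.comp_app, Category.assoc, Category.assoc, hr, hα, hβ, ← Category.assoc,
        ← latchingι_latchingObjMap, ← latchingι_latchingMap P u (hS hu), Category.assoc, hab,
        Category.assoc]
    · ext m
      refine Sieve.cofree_hom_ext fun u _ => ?_
      rw [Category.assoc, Category.assoc, pullback.lift_snd, pullback.lift_snd, NatTrans.comp_app,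
        NatTrans.comp_app, Category.assoc, Category.assoc, hp'', ← Category.assoc, hα, hγ,
        Category.assoc, hac, NatTrans.naturality_assoc]⟩
  have h₁ : sq.lift ≫ r E = β := by
    have := sq.fac_right =≫ pullback.fst p' (r B)
    rwa [Category.assoc, pullback.lift_fst, pullback.lift_fst] at this
  have h₂ : sq.lift ≫ p'' = γ := by
    have := sq.fac_right =≫ pullback.snd p' (r B)
    rwa [Category.assoc, pullback.lift_snd, pullback.lift_snd] at this
  refine ⟨sq.lift.app n ≫ (⊤ : Sieve n).cofreeπ E (𝟙 n) trivial, ?_,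
    latching_hom_ext _ fun k u hu' => ?_, ?_⟩
  · have := congr_app sq.fac_left n
    rw [NatTrans.comp_app] at this
    rw [reassoc_of% this, hα, P.map_id, Category.id_comp]
  · have hu : S u := hu'
    refine Eq.trans ?_ ((congr_app h₁ k =≫ S.cofreeπ E u hu).trans (hβ u hu))
    rw [NatTrans.comp_app, Category.assoc, hr, ← Category.assoc,
      latchingι_latchingMap, ← Category.assoc, NatTrans.naturality, Category.assoc,
      Sieve.map_cofreeπ]
    congr 2
    exact Category.comp_id u
  · rw [Category.assoc, ← hp'', ← Category.assoc, ← NatTrans.comp_app, h₂, hγ, Q.map_id,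
      Category.id_comp]

/-- The map from the initial cosimplicial object. -/
def initialTo (X : SimplexCategory ⥤ C) : (Functor.const SimplexCategory).obj (⊥_ C) ⟶ X where
  app n := initial.to (X.obj n)
  naturality _ _ _ := initial.hom_ext _ _

lemma isReedyCofibrant_of_llp {X : SimplexCategory ⥤ C}
    (hX : A.levelwiseAcyclicFib.llp (initialTo X)) : A.IsReedyCofibrant X := by
  intro n
  rw [← acyclicFib_llp]
  intro E B p hp
  refine ⟨fun {b c} sq => ?_⟩
  obtain ⟨d, -, hd₁, hd₂⟩ := isReedyCofibration_of_llp hX n p hp (initial.to E) b c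
    (latchingIncl_hom_ext _ fun x => initial.hom_ext _ _) (initial.hom_ext _ _) sq.w
  exact ⟨⟨⟨d, hd₁, hd₂⟩⟩⟩

end LeftSemimodelStructure

/-! ### The small object argument for cosimplicial objects -/

section

variable {C : Type u} [Category.{v} C] [HasColimits C]

lemma hasCoproductsOfShape_of_hasColimits (T : Type) : HasCoproductsOfShape T C :=
  have := hasColimitsOfSizeShrink.{0, 0, v, v} C
  inferInstance

attribute [local instance] hasCoproductsOfShape_of_hasColimits

/-- The coprojections to the values of the cosimplicial object freely generated by `K` in
degree `k`. -/
def evaluationLeftAdjointι {k n : SimplexCategory} (u : k ⟶ n) (K : C) :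
    K ⟶ ((evaluationLeftAdjoint C k).obj K).obj n :=
  Sigma.ι (fun _ : k ⟶ n => K) u

lemma evaluationLeftAdjoint_hom_ext {k n : SimplexCategory} {K E : C}
    {a b : ((evaluationLeftAdjoint C k).obj K).obj n ⟶ E}
    (h : ∀ u : k ⟶ n, evaluationLeftAdjointι u K ≫ a = evaluationLeftAdjointι u K ≫ b) : a = b :=
  Sigma.hom_ext _ _ h

lemma exists_evaluationLeftAdjoint_desc {k n : SimplexCategory} {K E : C}
    (t : ∀ _ : k ⟶ n, K ⟶ E) : ∃ a : ((evaluationLeftAdjoint C k).obj K).obj n ⟶ E,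
      ∀ u, evaluationLeftAdjointι u K ≫ a = t u :=
  ⟨Sigma.desc t, fun _ => Sigma.ι_desc _ _⟩

lemma evaluationLeftAdjointι_map_app {k n : SimplexCategory} (u : k ⟶ n) {K L : C} (i : K ⟶ L) :
    evaluationLeftAdjointι u K ≫ ((evaluationLeftAdjoint C k).map i).app n =
      i ≫ evaluationLeftAdjointι u L :=
  Sigma.ι_desc _ _

/-- A coproduct of cosimplicial objects freely generated by objects `K i` in degrees `k i`
is, in degree `n`, a coproduct of the `K i` indexed by the pairs of an `i` and a map
`[k i] ⟶ [n]`. -/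
lemma nonempty_isColimit_evaluation {ι : Type v} {k : ι → SimplexCategory} {K : ι → C}
    {c : Cofan (fun i => (evaluationLeftAdjoint C (k i)).obj (K i))} (hc : IsColimit c)
    (n : SimplexCategory) :
    Nonempty (IsColimit (Cofan.mk (f := fun x : Σ i, (k i ⟶ n) => K x.1) (c.pt.obj n)
      (fun x => evaluationLeftAdjointι x.2 (K x.1) ≫ (c.inj x.1).app n))) := by
  have hc' : IsColimit (Cofan.mk (c.pt.obj n) (fun i => (c.inj i).app n)) :=
    isColimitCofanMkObjOfIsColimit ((evaluation SimplexCategory C).obj n) _ _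
      (IsColimit.ofIsoColimit hc (Cocone.ext (Iso.refl _)))
  choose d hd using fun (s : Cofan (fun x : Σ i, (k i ⟶ n) => K x.1)) i =>
    exists_evaluationLeftAdjoint_desc (fun u : k i ⟶ n => s.inj ⟨i, u⟩)
  refine ⟨Cofan.IsColimit.mk _ (fun s => Cofan.IsColimit.desc hc' (d s)) (fun s x => ?_)
    (fun s m hm => Cofan.IsColimit.hom_ext hc' _ _ fun i => ?_)⟩
  · have h : (c.inj x.1).app n ≫ Cofan.IsColimit.desc hc' (d s) = d s x.1 :=
      Cofan.IsColimit.fac hc' (d s) x.1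
    exact (Category.assoc _ _ _).trans ((_ ≫= h).trans (hd s x.1 x.2))
  · refine Eq.trans ?_ (Cofan.IsColimit.fac hc' (d s) i).symm
    refine evaluationLeftAdjoint_hom_ext fun u => ?_
    rw [hd, ← hm ⟨i, u⟩]
    exact (Category.assoc _ _ _).symm

/-- Given a class `I` of maps, the maps between cosimplicial objects which are freely generated
by a map in `I` in some degree. -/
def projectiveCells (I : MorphismProperty C) : MorphismProperty (SimplexCategory ⥤ C) :=
  MorphismProperty.ofHoms (fun x : SimplexCategory × I.toSet =>
    (evaluationLeftAdjoint C x.1).map x.2.1.hom)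

lemma projectiveCells_rlp_iff (I : MorphismProperty C) {X Y : SimplexCategory ⥤ C} (f : X ⟶ Y) :
    (projectiveCells I).rlp f ↔ ∀ n, I.rlp (f.app n) := by
  constructor
  · intro h n K L i hi
    have hi' : projectiveCells I ((evaluationLeftAdjoint C n).map i) :=
      MorphismProperty.ofHoms.mk (f := fun x : SimplexCategory × I.toSet =>
        (evaluationLeftAdjoint C x.1).map x.2.1.hom) (n, ⟨Arrow.mk i, hi⟩)
    exact ((evaluationAdjunctionRight C n).hasLiftingProperty_iff _ _).1 (h _ hi')
  · rintro h _ _ _ ⟨n, i, hi⟩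
    exact ((evaluationAdjunctionRight C n).hasLiftingProperty_iff _ _).2 (h n _ hi)

/-- Attaching freely generated cells to a cosimplicial object attaches cells in each degree. -/
lemma nonempty_attachCells_evaluation {I : MorphismProperty C} {X Y : SimplexCategory ⥤ C}
    {f : X ⟶ Y} (c : AttachCells.{v} (projectiveCells I).homFamily f) (n : SimplexCategory) :
    Nonempty (AttachCells.{v} I.homFamily (f.app n)) := by
  have hc := c.pushouts_coproducts
  rw [MorphismProperty.ofHoms_homFamily, projectiveCells, ← nonempty_attachCells_iff] at hc
  obtain ⟨c⟩ := hc
  obtain ⟨h₁⟩ := nonempty_isColimit_evaluation c.isColimit₁ n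
  obtain ⟨h₂⟩ := nonempty_isColimit_evaluation c.isColimit₂ n
  exact ⟨{
    ι := Σ i, ((c.π i).1 ⟶ n)
    π := fun x => (c.π x.1).2
    cofan₁ := _
    cofan₂ := _
    isColimit₁ := h₁
    isColimit₂ := h₂
    m := c.m.app n
    hm := fun ⟨i, u⟩ => by
      refine (Category.assoc _ _ _).trans ((_ ≫= congr_app (c.hm i) n).trans ?_)
      exact (Category.assoc _ _ _).symm.trans
        ((evaluationLeftAdjointι_map_app u _ =≫ _).trans (Category.assoc _ _ _))
    g₁ := c.g₁.app n
    g₂ := c.g₂.app n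
    isPushout := c.isPushout.map ((evaluation SimplexCategory C).obj n) }⟩

/-- The sources of the maps in `projectiveCells I` are freely generated by sources of maps in `I`,
and mapping out of them evaluates in one degree, where cell complexes are cell complexes. -/
lemma hasSmallObjectArgument_projectiveCells (I : MorphismProperty C)
    [MorphismProperty.HasSmallObjectArgument.{v} I] :
    MorphismProperty.HasSmallObjectArgument.{v} (projectiveCells I) := by
  obtain ⟨κ, _, _, hκ⟩ := MorphismProperty.HasSmallObjectArgument.exists_cardinal.{v} (I := I)
  have := hκ.isSmall
  refine ⟨κ, inferInstance, inferInstance,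
    { isSmall := ?_
      locallySmall := inferInstance
      preservesColimit := ?_ }⟩
  · have : Small.{v} (SimplexCategory × I.toSet) := inferInstance
    exact MorphismProperty.isSmall_ofHoms _
  · rintro _ _ X Y _ ⟨n, i, hi⟩ f hf
    let hf' : RelativeCellComplex.{v} (fun (_ : κ.ord.ToType) => I.homFamily) (f.app n) :=
      { toTransfiniteCompositionOfShape :=
          hf.toTransfiniteCompositionOfShape.map ((evaluation SimplexCategory C).obj n)
        attachCells := fun j hj =>
          (nonempty_attachCells_evaluation (hf.attachCells j hj) n).some }
    have : PreservesColimit hf.F ((evaluation SimplexCategory C).obj n ⋙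
        coyoneda.obj (Opposite.op i.left)) :=
      have : PreservesColimit (hf.F ⋙ (evaluation SimplexCategory C).obj n)
        (coyoneda.obj (Opposite.op i.left)) := hκ.preservesColimit _ hi _ hf'
      inferInstance
    let e : (evaluation SimplexCategory C).obj n ⋙ coyoneda.obj (Opposite.op i.left) ≅
        coyoneda.obj (Opposite.op ((evaluationLeftAdjoint C n).obj i.left)) :=
      NatIso.ofComponents
        (fun Z => ((evaluationAdjunctionRight C n).homEquiv i.left Z).symm.toIso)
        (fun θ => by
          ext a
          exact (evaluationAdjunctionRight C n).homEquiv_naturality_right_symm _ _)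
    exact preservesColimit_of_natIso _ e

end

namespace LeftSemimodelStructure

variable {C : Type u} [Category.{v} C] [HasLimits C] [HasColimits C]
  {A : LeftSemimodelStructure C}

/-- Every map of cosimplicial objects is a projective cofibration followed by a levelwise acyclic
fibration. -/
lemma exists_projective_factorization (hA : A.IsTractable) {X Y : SimplexCategory ⥤ C}
    (f : X ⟶ Y) : ∃ (Z : SimplexCategory ⥤ C) (i : X ⟶ Z) (p : Z ⟶ Y),
      A.levelwiseAcyclicFib.llp i ∧ A.levelwiseAcyclicFib p ∧ i ≫ p = f := by
  obtain ⟨I, J, h, -⟩ := hA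
  have := h.smallObjectArgument_I
  have := hasSmallObjectArgument_projectiveCells I
  have hI : (projectiveCells I).rlp = A.levelwiseAcyclicFib := by
    ext X Y f
    rw [projectiveCells_rlp_iff, levelwiseAcyclicFib, h.acyclicFib_eq]
  let F := MorphismProperty.factorizationData (projectiveCells I).rlp.llp (projectiveCells I).rlp f
  exact ⟨F.Z, F.i, F.p, hI ▸ F.hi, hI ▸ F.hp, F.fac⟩

/-- Every map has a cosimplicial resolution which is a Reedy cofibration. -/
lemma exists_resolution (hA : A.IsTractable) {X Y : C} (f : X ⟶ Y) :
    ∃ (RX : A.CosimplicialResolution X) (RY : A.CosimplicialResolution Y) (φ : RX.obj ⟶ RY.obj),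
      φ ≫ RY.π = RX.π ≫ (Functor.const SimplexCategory).map f ∧ A.IsReedyCofibration φ := by
  obtain ⟨P, i, p, hi, hp, -⟩ := exists_projective_factorization hA
    (initialTo ((Functor.const SimplexCategory).obj X))
  obtain ⟨Q, φ, q, hφ, hq, fac⟩ := exists_projective_factorization hA
    (p ≫ (Functor.const SimplexCategory).map f)
  obtain rfl : i = initialTo P := by
    ext n
    exact initial.hom_ext _ _
  refine ⟨⟨P, p, isReedyCofibrant_of_llp hi, fun n => (hp n).2⟩,
    ⟨Q, q, isReedyCofibrant_of_llp ?_, fun n => (hq n).2⟩, φ, fac, isReedyCofibration_of_llp hφ⟩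
  have : initialTo Q = initialTo P ≫ φ := by
    ext n
    exact initial.hom_ext _ _
  rw [this]
  exact MorphismProperty.comp_mem _ _ _ hi hφ

end LeftSemimodelStructure

/-! ### Local objects and Quillen pairs between localizations -/

namespace LeftSemimodelStructure

variable {C : Type u} [Category.{v} C] [HasLimits C] [HasColimits C]
  {A L : LeftSemimodelStructure C}

lemma acyclicFib_eq_of_cof_eq (h : L.cof = A.cof) : L.acyclicFib = A.acyclicFib := by
  rw [← cof_rlp, ← cof_rlp, h]

/-- If `L` has the same cofibrations as `A` and at least as many weak equivalences, then the maps
that become weak equivalences in `L` induce weak homotopy equivalences of the mapping spaces of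
`A` into the fibrant objects of `L`. -/
lemma inducesEquivalenceOnMap_of_weq (hA : A.IsTractable) (hc : L.cof = A.cof)
    (hw : A.weq ≤ L.weq) {X Y Z : C} {f : X ⟶ Y} (hf : L.weq f) (hZ : L.IsFibrant Z) :
    A.InducesEquivalenceOnMap f Z := by
  obtain ⟨RX, RY, φ, hφ, hR⟩ := exists_resolution hA f
  have hR' : L.IsReedyCofibration φ := fun n _ _ p hp =>
    hR n p (acyclicFib_eq_of_cof_eq hc ▸ hp)
  have hRX : L.IsReedyCofibrant RX.obj := fun n => hc ▸ RX.reedyCofibrant n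
  refine ⟨RX, RY, φ, hφ, hR'.isWeakHomotopyEquivalence hRX (fun n => ?_) hZ⟩
  refine L.weq_of_postcomp (hw _ (RY.weq_π n)) ?_
  have h : φ.app n ≫ RY.π.app n = RX.π.app n ≫ f := congr_app hφ n
  rw [h]
  exact L.weq_comp (hw _ (RX.weq_π n)) hf

lemma weq_le_localEquivalences (hA : A.IsTractable) (S : MorphismProperty C) :
    A.weq ≤ A.localEquivalences S :=
  fun _ _ _ hf _ hZ => inducesEquivalenceOnMap_of_weq hA rfl le_rfl hf hZ.1

namespace IsLeftBousfieldLocalization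

variable {S : MorphismProperty C} (h : A.IsLeftBousfieldLocalization S L)

include h

/-- An object which is fibrant both in `A` and in its localization at `S` is `S`-local. -/
lemma isLocal_of_isFibrant (hA : A.IsTractable) {Z : C} (hZ : A.IsFibrant Z)
    (hZ' : L.IsFibrant Z) : A.IsLocal S Z :=
  ⟨hZ, fun _ _ s hs => inducesEquivalenceOnMap_of_weq hA h.cof_eq
    (h.weq_eq ▸ weq_le_localEquivalences hA S)
    (h.weq_eq ▸ fun _ hW => hW.2 s hs) hZ'⟩

/-- Local objects are fibrant in the localization. -/
lemma isFibrant_of_isLocal (hL : L.IsTractable) {Z : C} (hZ : A.IsLocal S Z) :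
    L.IsFibrant Z := by
  obtain ⟨I, J, hIJ, -, hJ⟩ := hL
  rw [IsFibrant, hIJ.fib_eq]
  intro K K' j hj
  have hj' := hIJ.le_acyclicCof _ hj
  have hw : A.localEquivalences S j := h.weq_eq ▸ hj'.2
  refine ⟨fun {k g} sq => ?_⟩
  have hK : A.IsCofibrant K := by
    have := hJ j hj
    rwa [IsCofibrant, h.cof_eq] at this
  obtain ⟨l, hl⟩ := (hw Z hZ).exists_extension (h.cof_eq ▸ hj'.1) hK hZ.1 k
  exact ⟨⟨⟨l, hl, by subsingleton⟩⟩⟩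

end IsLeftBousfieldLocalization

end LeftSemimodelStructure

lemma IsQuillenPair.isFibrant_obj {M : Type u₁} [Category.{v} M] [HasLimits M] [HasColimits M]
    {N : Type u₂} [Category.{v} N] [HasLimits N] [HasColimits N]
    {F : M ⥤ N} {U : N ⥤ M} {adj : F ⊣ U}
    {A : LeftSemimodelStructure M} {B : LeftSemimodelStructure N} (h : IsQuillenPair adj A B)
    {Z : N} (hZ : B.IsFibrant Z) : A.IsFibrant (U.obj Z) := by
  have hU : IsTerminal (U.obj (⊤_ N)) :=
    have := adj.isRightAdjoint
    IsTerminal.isTerminalObj U _ terminalIsTerminal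
  have := A.fib_retract
  refine (MorphismProperty.arrow_mk_iso_iff A.fib ?_).1 (h.map_fib _ hZ)
  exact Arrow.isoMk (Iso.refl _) (hU.uniqueUpToIso terminalIsTerminal)
    (terminalIsTerminal.hom_ext _ _)

end

theorem lemma3p5
    {M : Type u₁} [Category.{v} M] [HasLimits M] [HasColimits M]
    {N : Type u₂} [Category.{v} N] [HasLimits N] [HasColimits N]
    (A : LeftSemimodelStructure M) (hA : A.IsTractable)
    (B : LeftSemimodelStructure N) (hB : B.IsTractable)
    {F : M ⥤ N} {U : N ⥤ M} (adj : F ⊣ U) (hFU : IsQuillenPair adj A B)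
    (S : MorphismProperty M) (hS : MorphismProperty.IsSmall.{v} S)
    (T : MorphismProperty N) (hT : MorphismProperty.IsSmall.{v} T)
    (LA : LeftSemimodelStructure M) (hLA : A.IsLeftBousfieldLocalization S LA)
    (hLA' : LA.IsTractable)
    (LB : LeftSemimodelStructure N) (hLB : B.IsLeftBousfieldLocalization T LB)
    (hLB' : LB.IsTractable) :
    IsQuillenPair adj LA LB ↔ ∀ Z : N, B.IsLocal T Z → A.IsLocal S (U.obj Z) := by
  refine ⟨fun h Z hZ => hLA.isLocal_of_isFibrant hA (hFU.isFibrant_obj hZ.1)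
    (h.isFibrant_obj (hLB.isFibrant_of_isLocal hLB' hZ)), fun h => ⟨fun X Y p hp => ?_, ?_⟩⟩
  · obtain ⟨I, J, hIJ, -, hJ⟩ := hLA'
    rw [hIJ.fib_eq]
    intro K K' j hj
    have hj' := hIJ.le_acyclicCof _ hj
    have hw : A.localEquivalences S j := hLA.weq_eq ▸ hj'.2
    have hc : A.cof j := hLA.cof_eq ▸ hj'.1
    have hK : A.IsCofibrant K := by
      have := hJ j hj
      rwa [LeftSemimodelStructure.IsCofibrant, hLA.cof_eq] at this
    rw [← adj.hasLiftingProperty_iff]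
    refine LB.lift_acyclicCof_fib _ _ ?_ ⟨?_, ?_⟩ hp
    · rw [hLB.cof_eq]
      exact hFU.map_isCofibrant hK
    · rw [hLB.cof_eq]
      exact hFU.map_cof hc
    · rw [hLB.weq_eq]
      exact fun Z hZ => hFU.inducesEquivalenceOnMap_map hK (hK.of_cof hc) (hw _ (h Z hZ))
  · rw [LeftSemimodelStructure.acyclicFib_eq_of_cof_eq hLA.cof_eq,
      LeftSemimodelStructure.acyclicFib_eq_of_cof_eq hLB.cof_eq]
    exact hFU.map_acyclicFib
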